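/- Let $\mathcal O=\mathbb C[[x_1,x_2]]\otimes\Lambda(\xi_1,\xi_2,\tau)$ and let $E=\sum_{i=1}^2\left(x_i\frac{\partial}{\partial x_i}+\xi_i\frac{\partial}{\partial \xi_i}\right)$. With reversed parity, $\mathcal O$ is a Lie superalgebra with the bracket $$[f,g]=(2-E)f\,\frac{\partial g}{\partial\tau}+(-1)^{p(f)}\frac{\partial f}{\partial\tau}(2-E)g-\sum_{i=1}^2\left(\frac{\partial f}{\partial x_i}\frac{\partial g}{\partial\xi_i}+(-1)^{p(f)}\frac{\partial f}{\partial\xi_i}\frac{\partial g}{\partial x_i}\right),$$ where $p$ is the parity in $\mathcal O$. For $\beta\in\mathbb C$ let $SKO(2,3;\beta)$ be the derived algebra of its subalgebra $\{f\in\mathcal O:\ \mathrm{div}_\beta f=0\}$, where $\mathrm{div}_\beta=\sum_{i=1}^2\frac{\partial^2}{\partial x_i\partial\xi_i}+(E-2\beta)\frac{\partial}{\partial\tau}$, with the $\mathbb Z$-grading of type $(0,0|1,1,1)$, i.e. $\mathfrak g_j$ consists of the elements homogeneous of degree $j+1$ in $\xi_1,\xi_2,\tau$. An anti-linear graded conjugation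 of $\mathfrak g=SKO(2,3;\beta)$ is an anti-linear Lie superalgebra automorphism $\sigma$ of $\mathfrak g$ such that $\sigma(\mathfrak g_j)=\mathfrak g_{-j}$ and $\sigma^2(x)=(-1)^jx$ for all $j\in\mathbb Z$, $x\in\mathfrak g_j$. **Lemma.** Let $\beta\in\mathbb C$, $\beta\neq\pm1$. Then $SKO(2,3;\beta)$ has an anti-linear graded conjugation if and only if $|\beta|=1$. Moreover, for $|\beta|=1$, $\beta\ne\pm1$, such a conjugation is given explicitly as follows. For a formal vector field $X=X_1\frac{\partial}{\partial x_1}+X_2\frac{\partial}{\partial x_2}$ with coefficients in $\mathbb C[[x_1,x_2]]$ put $D=\frac{\mathrm{div}(X)}{2(\beta+1)}$ and $\iota(X)=\sum_i(X_i-x_iD)\xi_i+D\tau$. Let $c\in\mathbb C$ be any number with $c^2=\bar\beta$, and for $f\in\mathbb C[[x_1,x_2]]$ put $fv=f$ and $fw=c\left(\frac{\partial f}{\partial x_2}\tau\xi_1-\frac{\partial f}{\partial x_1}\tau\xi_2+\left((E-2\beta)f\right)\xi_1\xi_2\right)$. All these elements lie in $SKO(2,3;\beta)$ (in $\mathfrak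 g_0$, $\mathfrak g_{-1}$, $\mathfrak g_1$ respectively), and there is exactly one anti-linear graded conjugation $\sigma$ with $$\sigma(\iota(X))=\iota(\overline X),\qquad \sigma(fv)=\bar f w,\qquad \sigma(fw)=-\bar f v$$ for all $X$ and $f$, where the bar is complex conjugation of coefficients. -/

import Mathlib

open scoped ComplexConjugate

noncomputable section

namespace SKO23

/-- The algebra `ℂ[[x₁, x₂]]` (the variables are indexed by `0, 1 : Fin 2`). -/
abbrev A : Type := MvPowerSeries (Fin 2) ℂ

/-- The underlying space of the superalgebra `ℂ[[x₁, x₂]] ⊗ Λ(ξ₁, ξ₂, τ)`.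
The odd variables `ξ₁, ξ₂, τ` are indexed by `0, 1, 2 : Fin 3`; the value of `f` at
`S = {i₁ < i₂ < …}` is the coefficient of the monomial `θ_{i₁} θ_{i₂} ⋯`, where
`θ₀ = ξ₁`, `θ₁ = ξ₂`, `θ₂ = τ`. -/
abbrev Superfn : Type := Finset (Fin 3) → A

/-- The sign in `θ_S θ_T = sgn S T • θ_{S ∪ T}` for disjoint `S, T`. -/
def sgn (S T : Finset (Fin 3)) : ℤ :=
  (-1) ^ ((S ×ˢ T).filter fun p => p.2 < p.1).card

/-- The associative, supercommutative product of `ℂ[[x₁, x₂]] ⊗ Λ(ξ₁, ξ₂, τ)`. -/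
def sprod (f g : Superfn) : Superfn := fun S =>
  ∑ T ∈ S.powerset, sgn T (S \ T) • (f T * g (S \ T))

/-- `∂/∂xᵢ`. -/
def dEven (i : Fin 2) (f : Superfn) : Superfn := fun S => MvPowerSeries.pderiv ℂ i (f S)

/-- The left derivative `∂/∂θᵢ`. -/
def dOdd (i : Fin 3) (f : Superfn) : Superfn := fun S =>
  if i ∈ S then 0 else ((-1 : ℤ) ^ (S.filter (· < i)).card) • f (insert i S)

/-- The index of `ξᵢ` among the odd variables. -/
def xi (i : Fin 2) : Fin 3 := i.castSucc

/-- The index of `τ` among the odd variables. -/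
def tau : Fin 3 := 2

/-- The parity operator `f ↦ (-1)^{p(f)} f`, where `p` is the parity in
`ℂ[[x₁, x₂]] ⊗ Λ(ξ₁, ξ₂, τ)`. -/
def par (f : Superfn) : Superfn := fun S => ((-1 : ℤ) ^ S.card) • f S

/-- The Euler operator `∑ xᵢ ∂/∂xᵢ` of `ℂ[[x₁, x₂]]`. -/
def eulerA (a : A) : A := ∑ i : Fin 2, MvPowerSeries.X i * MvPowerSeries.pderiv ℂ i a

/-- The Euler operator `E = ∑ᵢ (xᵢ ∂/∂xᵢ + ξᵢ ∂/∂ξᵢ)`; the operator `∑ᵢ ξᵢ ∂/∂ξᵢ` multiplies a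
monomial by the number of the `ξᵢ` in it. -/
def euler (f : Superfn) : Superfn := fun S => eulerA (f S) + (S.erase tau).card • f S

/-- The Lie superbracket of `KO(2,3)`, that is, of `ℂ[[x₁, x₂]] ⊗ Λ(ξ₁, ξ₂, τ)` with reversed
parity:
`[f,g] = (2-E)f ∂g/∂τ + (-1)^{p(f)} ∂f/∂τ (2-E)g
  - ∑ᵢ (∂f/∂xᵢ ∂g/∂ξᵢ + (-1)^{p(f)} ∂f/∂ξᵢ ∂g/∂xᵢ)`. -/
def bracket (f g : Superfn) : Superfn :=
  sprod ((2 : ℕ) • f - euler f) (dOdd tau g) + sprod (dOdd tau (par f)) ((2 : ℕ) • g - euler g)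
    - ∑ i : Fin 2, (sprod (dEven i f) (dOdd (xi i) g) + sprod (dOdd (xi i) (par f)) (dEven i g))

/-- The odd `β`-divergence `div_β = ∑ᵢ ∂²/∂xᵢ∂ξᵢ + (E - 2β) ∂/∂τ`. -/
def divb (β : ℂ) (f : Superfn) : Superfn :=
  ∑ i : Fin 2, dEven i (dOdd (xi i) f) + (euler (dOdd tau f) - (2 * β) • dOdd tau f)

theorem sprod_zero (f : Superfn) : sprod f 0 = 0 := by
  funext S; simp [sprod]

theorem zero_sprod (f : Superfn) : sprod 0 f = 0 := by
  funext S; simp [sprod]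

theorem bracket_zero (f : Superfn) : bracket f 0 = 0 := by
  have h1 : ∀ i, dOdd i 0 = 0 := fun i => by funext S; simp [dOdd]
  have h2 : ∀ i, dEven i 0 = 0 := fun i => by funext S; simp [dEven]
  have h3 : euler 0 = 0 := by funext S; simp [euler, eulerA]
  simp [bracket, h1, h2, h3, sprod_zero]

theorem zero_bracket (f : Superfn) : bracket 0 f = 0 := by
  have h0 : par 0 = 0 := by funext S; simp [par]
  have h1 : ∀ i, dOdd i 0 = 0 := fun i => by funext S; simp [dOdd]
  have h2 : ∀ i, dEven i 0 = 0 := fun i => by funext S; simp [dEven]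
  have h3 : euler 0 = 0 := by funext S; simp [euler, eulerA]
  simp [bracket, h0, h1, h2, h3, zero_sprod]

theorem finset3 (S : Finset (Fin 3)) : S = ∅ ∨ S = {0} ∨ S = {1} ∨ S = {2} ∨ S = {0, 1} ∨
    S = {0, 2} ∨ S = {1, 2} ∨ S = {0, 1, 2} := by
  revert S; decide

theorem pderiv_comm (a : A) : MvPowerSeries.pderiv ℂ 1 (MvPowerSeries.pderiv ℂ 0 a) =
    MvPowerSeries.pderiv ℂ 0 (MvPowerSeries.pderiv ℂ 1 a) := by
  ext n
  simp only [MvPowerSeries.coeff_pderiv]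
  simp [add_right_comm]
  ring

theorem sprod_term (f g : Superfn) {S T : Finset (Fin 3)} (U : Finset (Fin 3)) (c : ℤ)
    (hU : S \ T = U) (hc : sgn T U = c) :
    sgn T (S \ T) • (f T * g (S \ T)) = c • (f T * g U) := by
  rw [hU, hc]

theorem sprod_e (f g : Superfn) : sprod f g ∅ =
    f ∅ * g ∅ := by
  have h : (∅ : Finset (Fin 3)).powerset = {∅} := by decide
  simp only [sprod, h]
  rw [Finset.sum_singleton, sprod_term f g (T := ∅) ∅ 1 (by decide) (by decide)]
  module

theorem sprod_0 (f g : Superfn) : sprod f g {0} =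
    f ∅ * g {0} + f {0} * g ∅ := by
  have h : ({0} : Finset (Fin 3)).powerset = {∅, {0}} := by decide
  simp only [sprod, h]
  repeat rw [Finset.sum_insert (by decide)]
  rw [Finset.sum_singleton, sprod_term f g (T := ∅) {0} 1 (by decide) (by decide),
    sprod_term f g (T := {0}) ∅ 1 (by decide) (by decide)]
  module

theorem sprod_1 (f g : Superfn) : sprod f g {1} =
    f ∅ * g {1} + f {1} * g ∅ := by
  have h : ({1} : Finset (Fin 3)).powerset = {∅, {1}} := by decide
  simp only [sprod, h]
  repeat rw [Finset.sum_insert (by decide)]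
  rw [Finset.sum_singleton, sprod_term f g (T := ∅) {1} 1 (by decide) (by decide),
    sprod_term f g (T := {1}) ∅ 1 (by decide) (by decide)]
  module

theorem sprod_2 (f g : Superfn) : sprod f g {2} =
    f ∅ * g {2} + f {2} * g ∅ := by
  have h : ({2} : Finset (Fin 3)).powerset = {∅, {2}} := by decide
  simp only [sprod, h]
  repeat rw [Finset.sum_insert (by decide)]
  rw [Finset.sum_singleton, sprod_term f g (T := ∅) {2} 1 (by decide) (by decide),
    sprod_term f g (T := {2}) ∅ 1 (by decide) (by decide)]
  module

theorem sprod_01 (f g : Superfn) : sprod f g {0, 1} =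
    f ∅ * g {0, 1} + f {0} * g {1} - f {1} * g {0} + f {0, 1} * g ∅ := by
  have h : ({0, 1} : Finset (Fin 3)).powerset = {∅, {0}, {1}, {0, 1}} := by decide
  simp only [sprod, h]
  repeat rw [Finset.sum_insert (by decide)]
  rw [Finset.sum_singleton, sprod_term f g (T := ∅) {0, 1} 1 (by decide) (by decide),
    sprod_term f g (T := {0}) {1} 1 (by decide) (by decide),
    sprod_term f g (T := {1}) {0} (-1) (by decide) (by decide),
    sprod_term f g (T := {0, 1}) ∅ 1 (by decide) (by decide)]
  module

theorem sprod_02 (f g : Superfn) : sprod f g {0, 2} =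
    f ∅ * g {0, 2} + f {0} * g {2} - f {2} * g {0} + f {0, 2} * g ∅ := by
  have h : ({0, 2} : Finset (Fin 3)).powerset = {∅, {0}, {2}, {0, 2}} := by decide
  simp only [sprod, h]
  repeat rw [Finset.sum_insert (by decide)]
  rw [Finset.sum_singleton, sprod_term f g (T := ∅) {0, 2} 1 (by decide) (by decide),
    sprod_term f g (T := {0}) {2} 1 (by decide) (by decide),
    sprod_term f g (T := {2}) {0} (-1) (by decide) (by decide),
    sprod_term f g (T := {0, 2}) ∅ 1 (by decide) (by decide)]
  module

theorem sprod_12 (f g : Superfn) : sprod f g {1, 2} =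
    f ∅ * g {1, 2} + f {1} * g {2} - f {2} * g {1} + f {1, 2} * g ∅ := by
  have h : ({1, 2} : Finset (Fin 3)).powerset = {∅, {1}, {2}, {1, 2}} := by decide
  simp only [sprod, h]
  repeat rw [Finset.sum_insert (by decide)]
  rw [Finset.sum_singleton, sprod_term f g (T := ∅) {1, 2} 1 (by decide) (by decide),
    sprod_term f g (T := {1}) {2} 1 (by decide) (by decide),
    sprod_term f g (T := {2}) {1} (-1) (by decide) (by decide),
    sprod_term f g (T := {1, 2}) ∅ 1 (by decide) (by decide)]
  module

theorem sprod_012 (f g : Superfn) : sprod f g {0, 1, 2} =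
    f ∅ * g {0, 1, 2} + f {0} * g {1, 2} - f {1} * g {0, 2} + f {2} * g {0, 1} + f {0, 1} * g {2} - f {0, 2} * g {1} + f {1, 2} * g {0} + f {0, 1, 2} * g ∅ := by
  have h : ({0, 1, 2} : Finset (Fin 3)).powerset = {∅, {0}, {1}, {2}, {0, 1}, {0, 2}, {1, 2}, {0, 1, 2}} := by decide
  simp only [sprod, h]
  repeat rw [Finset.sum_insert (by decide)]
  rw [Finset.sum_singleton, sprod_term f g (T := ∅) {0, 1, 2} 1 (by decide) (by decide),
    sprod_term f g (T := {0}) {1, 2} 1 (by decide) (by decide),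
    sprod_term f g (T := {1}) {0, 2} (-1) (by decide) (by decide),
    sprod_term f g (T := {2}) {0, 1} 1 (by decide) (by decide),
    sprod_term f g (T := {0, 1}) {2} 1 (by decide) (by decide),
    sprod_term f g (T := {0, 2}) {1} (-1) (by decide) (by decide),
    sprod_term f g (T := {1, 2}) {0} 1 (by decide) (by decide),
    sprod_term f g (T := {0, 1, 2}) ∅ 1 (by decide) (by decide)]
  module

theorem dOdd_0 (f : Superfn) : dOdd 0 f ∅ = f {0} ∧
    dOdd 0 f {0} = 0 ∧
    dOdd 0 f {1} = f {0, 1} ∧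
    dOdd 0 f {2} = f {0, 2} ∧
    dOdd 0 f {0, 1} = 0 ∧
    dOdd 0 f {0, 2} = 0 ∧
    dOdd 0 f {1, 2} = f {0, 1, 2} ∧
    dOdd 0 f {0, 1, 2} = 0 := by
  refine ⟨?_, ?_, ?_, ?_, ?_, ?_, ?_, ?_⟩ <;>
    simp (decide := true) [dOdd]

theorem dOdd_1 (f : Superfn) : dOdd 1 f ∅ = f {1} ∧
    dOdd 1 f {0} = -f {0, 1} ∧
    dOdd 1 f {1} = 0 ∧
    dOdd 1 f {2} = f {1, 2} ∧
    dOdd 1 f {0, 1} = 0 ∧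
    dOdd 1 f {0, 2} = -f {0, 1, 2} ∧
    dOdd 1 f {1, 2} = 0 ∧
    dOdd 1 f {0, 1, 2} = 0 := by
  refine ⟨?_, ?_, ?_, ?_, ?_, ?_, ?_, ?_⟩ <;>
    simp (decide := true) [dOdd] <;> exact congrArg f (by decide)

theorem dOdd_2 (f : Superfn) : dOdd 2 f ∅ = f {2} ∧
    dOdd 2 f {0} = -f {0, 2} ∧
    dOdd 2 f {1} = -f {1, 2} ∧
    dOdd 2 f {2} = 0 ∧
    dOdd 2 f {0, 1} = f {0, 1, 2} ∧
    dOdd 2 f {0, 2} = 0 ∧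
    dOdd 2 f {1, 2} = 0 ∧
    dOdd 2 f {0, 1, 2} = 0 := by
  refine ⟨?_, ?_, ?_, ?_, ?_, ?_, ?_, ?_⟩ <;>
    simp (decide := true) [dOdd] <;> exact congrArg f (by decide)

theorem euler_apply (f : Superfn) (S : Finset (Fin 3)) : euler f S =
    MvPowerSeries.X 0 * MvPowerSeries.pderiv ℂ 0 (f S) +
    MvPowerSeries.X 1 * MvPowerSeries.pderiv ℂ 1 (f S) + (S.erase 2).card • f S := by
  simp [euler, eulerA, tau, Fin.sum_univ_two]

theorem card_vals : (({0} : Finset (Fin 3)).erase 2).card = 1 ∧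
    (({1} : Finset (Fin 3)).erase 2).card = 1 ∧ (({2} : Finset (Fin 3)).erase 2).card = 0 ∧
    (({0, 1} : Finset (Fin 3)).erase 2).card = 2 ∧ (({0, 2} : Finset (Fin 3)).erase 2).card = 1 ∧
    (({1, 2} : Finset (Fin 3)).erase 2).card = 1 ∧
    (({0, 1, 2} : Finset (Fin 3)).erase 2).card = 2 ∧
    ((∅ : Finset (Fin 3)).erase 2).card = 0 ∧
    ({0, 1} : Finset (Fin 3)).card = 2 ∧ ({0, 2} : Finset (Fin 3)).card = 2 ∧
    ({1, 2} : Finset (Fin 3)).card = 2 ∧ ({0, 1, 2} : Finset (Fin 3)).card = 3 := by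
  decide

set_option maxRecDepth 20000 in
set_option maxHeartbeats 4000000 in
/-- How `div_β` interacts with the bracket. -/
theorem divb_bracket (β : ℂ) (f g : Superfn) : divb β (bracket f g) =
    bracket (divb β f) g - bracket (par f) (divb β g)
      + (2 : ℕ) • sprod (dOdd tau f) (divb β g) - (2 : ℕ) • sprod (divb β f) (dOdd tau g) := by
  have hxi0 : xi 0 = 0 := rfl
  have hxi1 : xi 1 = 1 := rfl
  have ht : tau = 2 := rfl
  have h0 := dOdd_0
  have h1 := dOdd_1
  have h2 := dOdd_2
  have hX : MvPowerSeries.pderiv ℂ (0 : Fin 2) (MvPowerSeries.X 1) = 0 :=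
    MvPowerSeries.pderiv_X_of_ne (by decide)
  have hX' : MvPowerSeries.pderiv ℂ (1 : Fin 2) (MvPowerSeries.X 0) = 0 :=
    MvPowerSeries.pderiv_X_of_ne (by decide)
  have hs : ∀ a : A, (2 * β) • a = MvPowerSeries.C (2 * β) * a := fun a => by
    rw [MvPowerSeries.smul_eq_C_mul]
  have hn : ∀ (n : ℕ) (a : A), n • a = (n : A) * a := fun n a => nsmul_eq_mul n a
  have hz : ∀ (n : ℤ) (a : A), n • a = (n : A) * a := fun n a => zsmul_eq_mul a n
  funext S
  obtain h | h | h | h | h | h | h | h := finset3 S <;> subst h <;>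
  simp only [divb, bracket, hxi0, hxi1, ht, Fin.sum_univ_two, Pi.add_apply, Pi.sub_apply,
    Pi.smul_apply, dEven, h0, h1, h2, euler_apply, card_vals, sprod_e, sprod_0, sprod_1, sprod_2,
    sprod_01, sprod_02, sprod_12, sprod_012, par, hs, Finset.card_empty, Finset.card_singleton,
    map_add, map_sub, map_neg, Derivation.leibniz, smul_eq_mul, pderiv_comm,
    MvPowerSeries.pderiv_X_self, hX, hX', MvPowerSeries.pderiv_C, hn, hz,
    map_zero, Derivation.map_natCast, Derivation.map_intCast] <;>
  push_cast <;> ring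

/-- The space of all `f` with `div_β f = 0`; it is a subalgebra of `KO(2,3)`. -/
def divFree (β : ℂ) : Submodule ℂ Superfn where
  carrier := {f | divb β f = 0}
  zero_mem' := by
    show divb β 0 = 0
    have h1 : ∀ i, dOdd i 0 = 0 := fun i => by funext S; simp [dOdd]
    have h2 : ∀ i, dEven i 0 = 0 := fun i => by funext S; simp [dEven]
    have h3 : euler 0 = 0 := by funext S; simp [euler, eulerA]
    simp [divb, h1, h2, h3]
  add_mem' {f g} hf hg := by
    show divb β (f + g) = 0
    have hf' : divb β f = 0 := hf
    have hg' : divb β g = 0 := hg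
    have h1 : ∀ i, dOdd i (f + g) = dOdd i f + dOdd i g := fun i => by
      funext S; by_cases h : i ∈ S <;> simp [dOdd, h]
    have h2 : ∀ i (u v : Superfn), dEven i (u + v) = dEven i u + dEven i v := fun i u v => by
      funext S; simp [dEven]
    have h3 : ∀ u v : Superfn, euler (u + v) = euler u + euler v := fun u v => by
      funext S; simp [euler, eulerA, mul_add]; ring
    have : divb β (f + g) = divb β f + divb β g := by
      simp only [divb, h1, h2, h3, Fin.sum_univ_two, smul_add]; abel
    rw [this, hf', hg', add_zero]
  smul_mem' c f hf := by
    show divb β (c • f) = 0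
    have hf' : divb β f = 0 := hf
    have h1 : ∀ i, dOdd i (c • f) = c • dOdd i f := fun i => by
      funext S; by_cases h : i ∈ S <;> simp [dOdd, h, smul_comm]
    have h2 : ∀ i (u : Superfn), dEven i (c • u) = c • dEven i u := fun i u => by
      funext S; simp [dEven]
    have h3 : ∀ u : Superfn, euler (c • u) = c • euler u := fun u => by
      funext S; simp [euler, eulerA, smul_add, smul_comm]
    have : divb β (c • f) = c • divb β f := by
      simp only [divb, h1, h2, h3, Fin.sum_univ_two, smul_add, smul_sub, smul_comm c]
    rw [this, hf', smul_zero]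

theorem bracket_mem_divFree {β : ℂ} {f g : Superfn} (hf : f ∈ divFree β) (hg : g ∈ divFree β) :
    bracket f g ∈ divFree β := by
  have hf' : divb β f = 0 := hf
  have hg' : divb β g = 0 := hg
  show divb β (bracket f g) = 0
  rw [divb_bracket, hf', hg', zero_bracket, bracket_zero, sprod_zero, zero_sprod]
  simp

/-- The Lie superalgebra `SKO(2,3;β)`: the derived algebra of `{f | div_β f = 0}`. (The two
coincide unless `β = 0` or `β = 1`.) -/
def SKO (β : ℂ) : Submodule ℂ Superfn :=
  Submodule.span ℂ {h | ∃ f ∈ divFree β, ∃ g ∈ divFree β, h = bracket f g}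

theorem SKO_le_divFree (β : ℂ) : SKO β ≤ divFree β := by
  refine Submodule.span_le.mpr ?_
  rintro h ⟨f, hf, g, hg, rfl⟩
  exact bracket_mem_divFree hf hg

/-- The Lie superbracket of `SKO(2,3;β)`. -/
def skoBracket {β : ℂ} (f g : SKO β) : SKO β :=
  ⟨bracket f g, Submodule.subset_span
    ⟨f, SKO_le_divFree β f.2, g, SKO_le_divFree β g.2, rfl⟩⟩

/-- The `j`-th component of the grading of type `(0,0|1,1,1)`. The bracket lowers the total
degree in the odd variables by one, so this component consists of the `f` that are
homogeneous of degree `j + 1` in `ξ₁, ξ₂, τ`. The Lie superalgebra parity of this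
component is `j` modulo `2`. -/
def grade (β : ℂ) (j : ℤ) : Set (SKO β) :=
  {f | ∀ S : Finset (Fin 3), (S.card : ℤ) ≠ j + 1 → (f : Superfn) S = 0}

/-- An anti-linear graded conjugation: an anti-linear Lie superalgebra automorphism `σ` with
`σ(𝔤_j) = 𝔤_{-j}` and `σ² = (-1)^j` on `𝔤_j`. (Parity is preserved by the second condition.) -/
structure IsGradedConj (β : ℂ) (σ : SKO β ≃ₛₗ[starRingEnd ℂ] SKO β) : Prop where
  map_bracket : ∀ f g : SKO β, σ (skoBracket f g) = skoBracket (σ f) (σ g)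
  map_grade : ∀ j : ℤ, σ '' grade β j = grade β (-j)
  sq : ∀ (j : ℤ), ∀ f ∈ grade β j, σ (σ f) = ((-1 : ℂ) ^ j) • f

/-- The element `a θ_S`. -/
def mono (S : Finset (Fin 3)) (a : A) : Superfn := Pi.single S a

/-- Complex conjugation of the coefficients of a power series. -/
def conjA (a : A) : A := MvPowerSeries.map (starRingEnd ℂ) a

/-- The divergence of the vector field `X₁ ∂/∂x₁ + X₂ ∂/∂x₂`. -/
def vdiv (X : Fin 2 → A) : A := ∑ i, MvPowerSeries.pderiv ℂ i (X i)

/-- The element `∑ᵢ (Xᵢ - xᵢ D) ξᵢ + D τ`, `D = div(X) / (2(β+1))`, of the degree `0` component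
that corresponds to the vector field `X = X₁ ∂/∂x₁ + X₂ ∂/∂x₂` for `β ≠ -1`. -/
def ofVec (β : ℂ) (X : Fin 2 → A) : Superfn :=
  ∑ i : Fin 2, mono {xi i} (X i - MvPowerSeries.X i * ((2 * (β + 1))⁻¹ • vdiv X))
    + mono {tau} ((2 * (β + 1))⁻¹ • vdiv X)

/-- The element `f` of the degree `-1` component; a vector field `X` (embedded by `ofVec`)
acts on it by `f ↦ X(f) - (β+1)⁻¹ div(X) f`. -/
def ofNeg (f : A) : Superfn := mono ∅ f

/-- The element `∂₂f τξ₁ - ∂₁f τξ₂ + (E - 2β)f ξ₁ξ₂` of the degree `1` component; a vector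
field `X` (embedded by `ofVec`) acts on it by `f ↦ X(f) - β(β+1)⁻¹ div(X) f`. -/
def ofPos (β : ℂ) (f : A) : Superfn :=
  mono {xi 0, tau} (-MvPowerSeries.pderiv ℂ 1 f)
    + mono {xi 1, tau} (MvPowerSeries.pderiv ℂ 0 f)
    + mono {xi 0, xi 1} (eulerA f - (2 * β) • f)

end SKO23

end

/-!
For `β ≠ ±1` the algebra `SKO(2,3;β)` lives in degrees `-1, 0, 1`. Degree `0` is the Lie algebra of
formal vector fields in the plane, and degrees `-1` and `1` are densities of the weights
`-(β+1)⁻¹` and `-β(β+1)⁻¹`: a field `V` acts by `f ↦ V(f) + l div(V) f`. Conjugating coefficients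
and exchanging the two modules is therefore possible when the two weights are complex conjugate,
i.e. when `|β| = 1`, and a direct computation shows that it is compatible with the pairing of the
two modules once the scalar satisfies `c² = conj β`.

Conversely, a graded conjugation `σ` restricts to an anti-linear automorphism `s` of the vector
fields. Compose the restriction of `σ` to one module, of weight `a`, with evaluation at the origin
in the other, of weight `b`. The resulting functional `T` satisfies `T(V·f) = b div(sV)(0) T(f)`
whenever `sV` vanishes at the origin. No `s(∂/∂v)` vanishes there, since `∂/∂v - t` is
surjective, so `s` maps `∂/∂x₁, ∂/∂x₂` to a commuting frame, and this forces the image of the Euler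
field to vanish at the origin and to have divergence `2` there. Hence `T` is an eigenvector of the
transpose of the Euler operator, whose eigenvalues are degrees of monomials: `2 conj b - 2 a` is a
natural number. Taking degree `1` for the first module gives the value `-2` if `β = 0`. If `β ≠ 0`,
exchanging the modules shows that `2 conj a - 2 b` is a natural number, too. It is the conjugate of
`-(2 conj b - 2 a)`, so both numbers vanish and the two weights are conjugate.
-/

noncomputable section

namespace SKO23

open MvPowerSeries (C X coeff constantCoeff pderiv)

section PowerSeries

theorem coeff_X_mul_pderiv {σ R : Type*} [CommSemiring R] (i : σ) (f : MvPowerSeries σ R)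
    (n : σ →₀ ℕ) : coeff n (X i * pderiv R i f) = n i * coeff n f := by
  classical
  rw [X, MvPowerSeries.coeff_monomial_mul, one_mul]
  split_ifs with h
  · have hi : n i - 1 + 1 = n i := Nat.sub_add_cancel (Finsupp.single_le_iff.mp h)
    rw [MvPowerSeries.coeff_pderiv, tsub_add_cancel_of_le h, Finsupp.tsub_apply,
      Finsupp.single_eq_same, ← Nat.cast_succ, Nat.succ_eq_add_one, hi, mul_comm]
  · have hi : n i = 0 := by simpa [Finsupp.single_le_iff] using h
    rw [hi, Nat.cast_zero, zero_mul]

/-- The equation is solved by recursion on the exponent of a variable `xᵢ` with `v i ≠ 0`. -/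
theorem exists_sum_smul_pderiv_sub_smul_eq {σ K : Type*} [Fintype σ] [Field K] [CharZero K]
    {v : σ → K} (hv : v ≠ 0) (s : K) (g : MvPowerSeries σ K) :
    ∃ f : MvPowerSeries σ K, ∑ j, v j • pderiv K j f - s • f = g := by
  classical
  obtain ⟨i, hi⟩ := Function.ne_iff.mp hv
  let e (j : σ) : σ →₀ ℕ := Finsupp.single j 1
  let next (m : ℕ) (c : (σ →₀ ℕ) → K) (n : σ →₀ ℕ) : K :=
    (coeff (n - e i) g + s * c (n - e i)
      - ∑ j ∈ Finset.univ.erase i, v j * (c (n - e i + e j) * (n j + 1))) / (v i * (m + 1))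
  let F : ℕ → (σ →₀ ℕ) → K := fun m => Nat.rec (fun _ => 0) next m
  let f : MvPowerSeries σ K := fun n => F (n i) n
  have hf (n) : coeff n f = F (n i) n := rfl
  have hne {j : σ} (hj : j ∈ Finset.univ.erase i) : j ≠ i := Finset.ne_of_mem_erase hj
  have hother (n : σ →₀ ℕ) : ∑ j ∈ Finset.univ.erase i, v j * coeff n (pderiv K j f) =
      ∑ j ∈ Finset.univ.erase i, v j * (F (n i) (n + e j) * (n j + 1)) :=
    Finset.sum_congr rfl fun j hj => by
      rw [MvPowerSeries.coeff_pderiv, hf, Finsupp.add_apply,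
        Finsupp.single_eq_of_ne (hne hj).symm, add_zero]
  have hself (n : σ →₀ ℕ) : v i * coeff n (pderiv K i f) = coeff n g + s * F (n i) n
      - ∑ j ∈ Finset.univ.erase i, v j * (F (n i) (n + e j) * (n j + 1)) := by
    have hstep : F ((n + e i) i) (n + e i) = next (n i) (F (n i)) (n + e i) := by
      simp only [e, Finsupp.add_apply, Finsupp.single_eq_same, F]
    have hsum : ∑ j ∈ Finset.univ.erase i, v j * (F (n i) (n + e j) * ((n + e i) j + 1)) =
        ∑ j ∈ Finset.univ.erase i, v j * (F (n i) (n + e j) * (n j + 1)) :=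
      Finset.sum_congr rfl fun j hj => by
        rw [Finsupp.add_apply, Finsupp.single_eq_of_ne (hne hj), add_zero]
    rw [MvPowerSeries.coeff_pderiv, hf, hstep]
    simp only [next, add_tsub_cancel_right]
    rw [← hsum]
    have : (n i + 1 : K) ≠ 0 := Nat.cast_add_one_ne_zero (n i)
    field_simp [show v i ≠ 0 from hi]
  refine ⟨f, MvPowerSeries.ext fun n => ?_⟩
  simp only [map_sub, map_sum, MvPowerSeries.coeff_smul]
  rw [← Finset.add_sum_erase _ _ (Finset.mem_univ i), hself, hother, hf]
  ring

theorem pderiv_X_zero_one : pderiv ℂ (0 : Fin 2) (X 1) = 0 :=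
  MvPowerSeries.pderiv_X_of_ne (by decide)

theorem pderiv_X_one_zero : pderiv ℂ (1 : Fin 2) (X 0) = 0 :=
  MvPowerSeries.pderiv_X_of_ne (by decide)

theorem exists_pderiv_zero_eq (g : A) : ∃ f : A, pderiv ℂ 0 f = g := by
  obtain ⟨f, hf⟩ := exists_sum_smul_pderiv_sub_smul_eq (v := ![1, 0]) (by simp) 0 g
  exact ⟨f, by simpa [Fin.sum_univ_two] using hf⟩

theorem ext_pderiv {a b : A} (h0 : pderiv ℂ 0 a = pderiv ℂ 0 b)
    (h1 : pderiv ℂ 1 a = pderiv ℂ 1 b) (hc : constantCoeff a = constantCoeff b) : a = b :=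
  MvPowerSeries.pderiv.ext (Fin.forall_fin_two.mpr ⟨h0, h1⟩) hc

/-- The derivation `∑ⱼ Vⱼ ∂/∂xⱼ` of `ℂ[[x₁, x₂]]` given by the formal vector field `V`. -/
def dirDeriv (V : Fin 2 → A) : Derivation ℂ A A := ∑ j, V j • pderiv ℂ j

theorem dirDeriv_apply (V : Fin 2 → A) (f : A) :
    dirDeriv V f = V 0 * pderiv ℂ 0 f + V 1 * pderiv ℂ 1 f := by
  simp [dirDeriv, Fin.sum_univ_two]

theorem eulerA_eq_dirDeriv (f : A) : eulerA f = dirDeriv X f := by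
  rw [dirDeriv_apply, eulerA, Fin.sum_univ_two]

theorem eulerA_apply (f : A) : eulerA f = X 0 * pderiv ℂ 0 f + X 1 * pderiv ℂ 1 f := by
  rw [eulerA_eq_dirDeriv, dirDeriv_apply]

theorem constantCoeff_eulerA (f : A) : constantCoeff (eulerA f) = 0 := by
  simp [eulerA_apply]

theorem coeff_eulerA (f : A) (n : Fin 2 →₀ ℕ) :
    coeff n (eulerA f) = (n.degree : ℂ) * coeff n f := by
  simp only [eulerA, Fin.sum_univ_two, map_add, coeff_X_mul_pderiv, Finsupp.degree_eq_sum,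
    Nat.cast_add, add_mul]

theorem exists_eulerA_add_smul_eq {t : ℂ} {g : A}
    (h : ∀ n : Fin 2 →₀ ℕ, (n.degree : ℂ) + t = 0 → coeff n g = 0) :
    ∃ f : A, eulerA f + t • f = g := by
  let f : A := fun n => coeff n g / (n.degree + t)
  have hf (n) : coeff n f = coeff n g / (n.degree + t) := rfl
  refine ⟨f, MvPowerSeries.ext fun n => ?_⟩
  rw [map_add, coeff_eulerA, MvPowerSeries.coeff_smul, ← add_mul, hf]
  exact mul_div_cancel_of_imp' (h n)

theorem eq_zero_of_eulerA_add_smul_eq_zero {t : ℂ} {f : A} (ht : ∀ k : ℕ, (k : ℂ) + t ≠ 0)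
    (h : eulerA f + t • f = 0) : f = 0 := by
  ext n
  have hn := congrArg (coeff n) h
  rw [map_add, coeff_eulerA, MvPowerSeries.coeff_smul, ← add_mul, map_zero] at hn
  rw [(mul_eq_zero.mp hn).resolve_left (ht _), map_zero]

theorem pderiv_eulerA (i : Fin 2) (f : A) :
    pderiv ℂ i (eulerA f) = eulerA (pderiv ℂ i f) + pderiv ℂ i f := by
  fin_cases i <;>
    simp only [Fin.zero_eta, Fin.mk_one, eulerA_apply, map_add, Derivation.leibniz, smul_eq_mul,
      pderiv_comm, pderiv_X_zero_one, pderiv_X_one_zero, MvPowerSeries.pderiv_X_self] <;>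
    ring

/-- The potential is found by integrating along rays: it solves `E φ = x₁ b - x₂ a`. -/
theorem exists_hamiltonian {a b : A} (h : pderiv ℂ 0 a + pderiv ℂ 1 b = 0) :
    ∃ φ : A, a = -pderiv ℂ 1 φ ∧ b = pderiv ℂ 0 φ := by
  obtain ⟨φ, hφ⟩ : ∃ φ : A, eulerA φ + (0 : ℂ) • φ = X 0 * b - X 1 * a := by
    refine exists_eulerA_add_smul_eq fun n hn => ?_
    rw [add_zero, Nat.cast_eq_zero, Finsupp.degree_eq_zero_iff] at hn
    simp [hn]
  rw [zero_smul, add_zero] at hφ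
  have hφ0 := pderiv_eulerA 0 φ
  have hφ1 := pderiv_eulerA 1 φ
  rw [hφ] at hφ0 hφ1
  simp only [map_sub, Derivation.leibniz, smul_eq_mul, pderiv_X_zero_one, pderiv_X_one_zero,
    MvPowerSeries.pderiv_X_self] at hφ0 hφ1
  have hinj {c : A} (hc : eulerA c + (1 : ℂ) • c = 0) : c = 0 :=
    eq_zero_of_eulerA_add_smul_eq_zero (fun k => Nat.cast_add_one_ne_zero k) hc
  refine ⟨φ, add_eq_zero_iff_eq_neg.mp (hinj ?_), sub_eq_zero.mp (hinj ?_)⟩ <;>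
    rw [one_smul, eulerA_eq_dirDeriv]
  · rw [map_add, ← eulerA_eq_dirDeriv (pderiv ℂ 1 φ), dirDeriv_apply]
    linear_combination X 0 * h - hφ1
  · rw [map_sub, ← eulerA_eq_dirDeriv (pderiv ℂ 0 φ), dirDeriv_apply]
    linear_combination X 1 * h + hφ0

end PowerSeries

section VectorFields

/-- Formal vector fields `V₁ ∂/∂x₁ + V₂ ∂/∂x₂` in the plane. -/
abbrev VecField : Type := Fin 2 → A

/-- The Lie bracket of formal vector fields. -/
def vbracket (V W : VecField) : VecField := fun i => dirDeriv V (W i) - dirDeriv W (V i)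

/-- The action `f ↦ V(f) + l div(V) f` of vector fields on densities of weight `l`. -/
def act (l : ℂ) (V : VecField) (f : A) : A := dirDeriv V f + l • (vdiv V * f)

/-- The weight of the densities that form the degree `-1` component of `SKO(2,3;β)`. -/
def negWeight (β : ℂ) : ℂ := -(β + 1)⁻¹

/-- The weight of the densities that form the degree `1` component of `SKO(2,3;β)`. -/
def posWeight (β : ℂ) : ℂ := -β * (β + 1)⁻¹

/-- The function `D = div(V) / (2(β+1))`, the `τ`-coefficient of `ofVec β V`. -/
def divCoeff (β : ℂ) (V : VecField) : A := (2 * (β + 1))⁻¹ • vdiv V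

/-- The vector field that corresponds to the bracket of `ofNeg a` and `ofPos β h`. -/
def pairing (β : ℂ) (a h : A) : VecField :=
  ![2 * (a * pderiv ℂ 1 h) - (2 * β) • (h * pderiv ℂ 1 a),
    (2 * β) • (h * pderiv ℂ 0 a) - 2 * (a * pderiv ℂ 0 h)]

variable {β : ℂ}

theorem mul_conj_eq_one_iff (z : ℂ) : z * conj z = 1 ↔ ‖z‖ = 1 := by
  rw [Complex.mul_conj', ← Complex.ofReal_pow, Complex.ofReal_eq_one,
    pow_eq_one_iff_of_nonneg (norm_nonneg z) two_ne_zero]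

theorem conj_negWeight_eq_posWeight_iff (hβ : β ≠ -1) :
    conj (negWeight β) = posWeight β ↔ ‖β‖ = 1 := by
  have h1 : β + 1 ≠ 0 := mt eq_neg_of_add_eq_zero_left hβ
  have h2 : conj β + 1 ≠ 0 := by simpa using (map_ne_zero (starRingEnd ℂ)).mpr h1
  have h3 : conj (negWeight β) = posWeight β ↔ β * conj β = 1 := by
    simp only [negWeight, posWeight, map_neg, map_inv₀, map_add, map_one]
    field_simp
    constructor <;> intro h <;> linear_combination h
  rw [h3, mul_conj_eq_one_iff]

theorem vdiv_apply (V : VecField) : vdiv V = pderiv ℂ 0 (V 0) + pderiv ℂ 1 (V 1) :=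
  Fin.sum_univ_two _

theorem vdiv_eq_smul_divCoeff (hβ : β ≠ -1) (V : VecField) :
    vdiv V = (2 * (β + 1)) • divCoeff β V := by
  rw [divCoeff, smul_inv_smul₀]
  exact mul_ne_zero two_ne_zero (mt eq_neg_of_add_eq_zero_left hβ)

theorem act_negWeight (V : VecField) (f : A) :
    act (negWeight β) V f = dirDeriv V f - (2 : ℂ) • (divCoeff β V * f) := by
  rw [act, divCoeff, negWeight, smul_mul_assoc, smul_smul, mul_inv,
    mul_inv_cancel_left₀ two_ne_zero, neg_smul, sub_eq_add_neg]

theorem act_posWeight (V : VecField) (h : A) :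
    act (posWeight β) V h = dirDeriv V h - (2 * β) • (divCoeff β V * h) := by
  rw [act, divCoeff, posWeight, smul_mul_assoc, smul_smul, mul_inv, mul_right_comm 2 β,
    mul_inv_cancel_left₀ two_ne_zero, mul_comm _ β, neg_mul, neg_smul, sub_eq_add_neg]

theorem vdiv_vbracket (V W : VecField) :
    vdiv (vbracket V W) = dirDeriv V (vdiv W) - dirDeriv W (vdiv V) := by
  simp only [vdiv_apply, vbracket, dirDeriv_apply, map_add, map_sub, Derivation.leibniz,
    smul_eq_mul, pderiv_comm]
  ring

theorem divCoeff_vbracket (V W : VecField) :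
    divCoeff β (vbracket V W) = dirDeriv V (divCoeff β W) - dirDeriv W (divCoeff β V) := by
  simp only [divCoeff, vdiv_vbracket, smul_sub, Derivation.map_smul]

theorem vdiv_pairing (a h : A) : vdiv (pairing β a h) =
    (2 * (β + 1)) • (pderiv ℂ 0 a * pderiv ℂ 1 h - pderiv ℂ 1 a * pderiv ℂ 0 h) := by
  have h2 (i : Fin 2) (g : A) : pderiv ℂ i (2 * g) = 2 * pderiv ℂ i g := by
    rw [two_mul, map_add, two_mul]
  simp only [vdiv_apply, pairing, Matrix.cons_val_zero, Matrix.cons_val_one, map_sub, h2,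
    Derivation.map_smul, Derivation.leibniz, smul_eq_mul, pderiv_comm]
  simp only [MvPowerSeries.smul_eq_C_mul, map_mul, map_add, map_ofNat, map_one]
  ring

theorem divCoeff_pairing (hβ : β ≠ -1) (a h : A) : divCoeff β (pairing β a h) =
    pderiv ℂ 0 a * pderiv ℂ 1 h - pderiv ℂ 1 a * pderiv ℂ 0 h := by
  rw [divCoeff, vdiv_pairing, inv_smul_smul₀]
  exact mul_ne_zero two_ne_zero (mt eq_neg_of_add_eq_zero_left hβ)

end VectorFields

section Coordinates

/-- Triples `(f, V, h)`, the coordinates of `SKO(2,3;β)` in degrees `-1`, `0`, `1`. -/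
abbrev Coords : Type := A × VecField × A

/-- The bracket of `SKO(2,3;β)` in coordinates. -/
def coordBracket (β : ℂ) (p q : Coords) : Coords :=
  (act (negWeight β) p.2.1 q.1 - act (negWeight β) q.2.1 p.1,
    vbracket p.2.1 q.2.1 + pairing β p.1 q.2.2 + pairing β q.1 p.2.2,
    act (posWeight β) p.2.1 q.2.2 - act (posWeight β) q.2.1 p.2.2)

variable {β : ℂ}

theorem xi_zero : xi 0 = 0 := rfl

theorem xi_one : xi 1 = 1 := rfl

theorem tau_eq_two : tau = 2 := rfl

theorem superfn_ext {u w : Superfn} (h : u ∅ = w ∅) (h0 : u {0} = w {0}) (h1 : u {1} = w {1})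
    (h2 : u {2} = w {2}) (h01 : u {0, 1} = w {0, 1}) (h02 : u {0, 2} = w {0, 2})
    (h12 : u {1, 2} = w {1, 2}) (h012 : u {0, 1, 2} = w {0, 1, 2}) : u = w := by
  funext S
  obtain rfl | rfl | rfl | rfl | rfl | rfl | rfl | rfl := finset3 S <;> assumption

/-- The element of `ℂ[[x₁, x₂]] ⊗ Λ(ξ₁, ξ₂, τ)` with coordinates `(f, V, h)`. -/
def emb (β : ℂ) (p : Coords) : Superfn := ofNeg p.1 + ofVec β p.2.1 + ofPos β p.2.2

theorem emb_apply (β : ℂ) (p : Coords) :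
    emb β p ∅ = p.1 ∧
    emb β p {0} = p.2.1 0 - X 0 * divCoeff β p.2.1 ∧
    emb β p {1} = p.2.1 1 - X 1 * divCoeff β p.2.1 ∧
    emb β p {2} = divCoeff β p.2.1 ∧
    emb β p {0, 1} = eulerA p.2.2 - (2 * β) • p.2.2 ∧
    emb β p {0, 2} = -pderiv ℂ 1 p.2.2 ∧
    emb β p {1, 2} = pderiv ℂ 0 p.2.2 ∧
    emb β p {0, 1, 2} = 0 := by
  refine ⟨?_, ?_, ?_, ?_, ?_, ?_, ?_, ?_⟩ <;>
    simp (decide := true) [emb, ofNeg, ofVec, ofPos, mono, xi_zero, xi_one, tau_eq_two,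
      Fin.sum_univ_two, divCoeff]

theorem emb_add (p q : Coords) : emb β (p + q) = emb β p + emb β q := by
  apply superfn_ext <;>
    simp only [emb_apply, Pi.add_apply, Prod.fst_add, Prod.snd_add, divCoeff, vdiv_apply,
      eulerA_apply, map_add, smul_add] <;>
    ring

theorem emb_smul (c : ℂ) (p : Coords) : emb β (c • p) = c • emb β p := by
  apply superfn_ext <;>
    simp only [emb_apply, Pi.smul_apply, Prod.smul_fst, Prod.smul_snd, divCoeff, vdiv_apply,
      eulerA_apply, Derivation.map_smul] <;>
    simp only [MvPowerSeries.smul_eq_C_mul, map_mul] <;>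
    ring

theorem divCoeff_coordBracket (hβ : β ≠ -1) (p q : Coords) :
    divCoeff β (coordBracket β p q).2.1 =
      dirDeriv p.2.1 (divCoeff β q.2.1) - dirDeriv q.2.1 (divCoeff β p.2.1)
      + (pderiv ℂ 0 p.1 * pderiv ℂ 1 q.2.2 - pderiv ℂ 1 p.1 * pderiv ℂ 0 q.2.2)
      + (pderiv ℂ 0 q.1 * pderiv ℂ 1 p.2.2 - pderiv ℂ 1 q.1 * pderiv ℂ 0 p.2.2) := by
  have hadd (V W : VecField) : divCoeff β (V + W) = divCoeff β V + divCoeff β W := by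
    simp only [divCoeff, vdiv_apply, Pi.add_apply, map_add, smul_add]
    ring
  simp only [coordBracket, hadd, divCoeff_vbracket, divCoeff_pairing hβ]

theorem bracket_emb (hβ : β ≠ -1) (p q : Coords) :
    bracket (emb β p) (emb β q) = emb β (coordBracket β p q) := by
  have hdiv (V : VecField) : pderiv ℂ 0 (V 0) + pderiv ℂ 1 (V 1) =
      2 * (C β + 1) * divCoeff β V := by
    rw [← vdiv_apply, vdiv_eq_smul_divCoeff hβ]
    simp only [MvPowerSeries.smul_eq_C_mul, map_mul, map_add, map_ofNat, map_one]
  obtain ⟨f, V, h⟩ := p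
  obtain ⟨g, W, k⟩ := q
  have hV := hdiv V
  have hW := hdiv W
  apply superfn_ext <;>
    simp only [bracket, xi_zero, xi_one, tau_eq_two, Fin.sum_univ_two, Pi.add_apply, Pi.sub_apply,
      Pi.smul_apply, dEven, dOdd_0, dOdd_1, dOdd_2, euler_apply, card_vals, sprod_e, sprod_0,
      sprod_1, sprod_2, sprod_01, sprod_02, sprod_12, sprod_012, par, emb_apply,
      divCoeff_coordBracket hβ, Finset.card_singleton] <;>
    simp only [coordBracket, act_negWeight, act_posWeight, vbracket, pairing, eulerA_apply,
      Pi.add_apply, Matrix.cons_val_zero, Matrix.cons_val_one, dirDeriv_apply,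
      Derivation.map_smul, map_add, map_sub, map_neg, Derivation.leibniz, pderiv_comm,
      pderiv_X_zero_one, pderiv_X_one_zero, MvPowerSeries.pderiv_X_self, map_zero] <;>
    simp only [smul_eq_mul, MvPowerSeries.smul_eq_C_mul, nsmul_eq_mul, zsmul_eq_mul, map_mul,
      map_ofNat] <;>
    push_cast
  case h01 =>
    linear_combination (2 * C β * k - X 0 * pderiv ℂ 0 k - X 1 * pderiv ℂ 1 k) * hV
      - (2 * C β * h - X 0 * pderiv ℂ 0 h - X 1 * pderiv ℂ 1 h) * hW
  case h02 => linear_combination pderiv ℂ 1 k * hV - pderiv ℂ 1 h * hW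
  case h12 => linear_combination pderiv ℂ 0 h * hW - pderiv ℂ 0 k * hV
  all_goals ring

end Coordinates

section DivFree

variable {β : ℂ}

theorem divb_apply (β : ℂ) (u : Superfn) :
    divb β u ∅ = pderiv ℂ 0 (u {0}) + pderiv ℂ 1 (u {1}) + (eulerA (u {2}) - (2 * β) • u {2}) ∧
    divb β u {0} = -pderiv ℂ 1 (u {0, 1}) -
      (eulerA (u {0, 2}) + u {0, 2} - (2 * β) • u {0, 2}) ∧
    divb β u {1} = pderiv ℂ 0 (u {0, 1}) -
      (eulerA (u {1, 2}) + u {1, 2} - (2 * β) • u {1, 2}) ∧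
    divb β u {2} = pderiv ℂ 0 (u {0, 2}) + pderiv ℂ 1 (u {1, 2}) ∧
    divb β u {0, 1} = eulerA (u {0, 1, 2}) + 2 * u {0, 1, 2} - (2 * β) • u {0, 1, 2} ∧
    divb β u {0, 2} = -pderiv ℂ 1 (u {0, 1, 2}) ∧
    divb β u {1, 2} = pderiv ℂ 0 (u {0, 1, 2}) ∧
    divb β u {0, 1, 2} = 0 := by
  refine ⟨?_, ?_, ?_, ?_, ?_, ?_, ?_, ?_⟩ <;>
    simp only [divb, xi_zero, xi_one, tau_eq_two, Fin.sum_univ_two, Pi.add_apply, Pi.sub_apply,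
      Pi.smul_apply, dEven, dOdd_0, dOdd_1, dOdd_2, euler_apply, card_vals, eulerA_apply,
      map_neg, map_zero, zero_smul, one_smul, smul_zero, smul_neg, two_smul] <;>
    ring

theorem emb_mem_divFree (hβ : β ≠ -1) (p : Coords) : emb β p ∈ divFree β := by
  change divb β (emb β p) = 0
  apply superfn_ext <;>
    simp only [divb_apply, emb_apply, Pi.zero_apply, map_sub, map_neg, Derivation.leibniz,
      MvPowerSeries.pderiv_X_self, smul_eq_mul, pderiv_eulerA, Derivation.map_smul, pderiv_comm,
      map_zero, neg_zero]
  case h =>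
    have hdiv := vdiv_eq_smul_divCoeff hβ p.2.1
    simp only [vdiv_apply, eulerA_apply, MvPowerSeries.smul_eq_C_mul, map_mul, map_add, map_ofNat,
      map_one] at hdiv ⊢
    linear_combination hdiv
  case h0 => rw [eulerA_eq_dirDeriv, eulerA_eq_dirDeriv, map_neg]; module
  case h1 => module
  case h2 => ring
  case h01 => simp [eulerA]

/-- The vector field given by the degree `0` component, so that `toVec (ofVec β V) = V`. -/
def toVec : Superfn →ₗ[ℂ] VecField where
  toFun u i := u {xi i} + X i * u {tau}
  map_add' u w := funext fun i => by simp only [Pi.add_apply, mul_add, add_add_add_comm]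
  map_smul' c u := funext fun i => by
    simp only [Pi.smul_apply, RingHom.id_apply, smul_add, mul_smul_comm]

theorem toVec_apply (u : Superfn) (i : Fin 2) : toVec u i = u {xi i} + X i * u {tau} := rfl

theorem toVec_emb (p : Coords) : toVec (emb β p) = p.2.1 := by
  ext1 i
  fin_cases i <;>
    simp only [Fin.zero_eta, Fin.mk_one, toVec_apply, xi_zero, xi_one, tau_eq_two,
      emb_apply, sub_add_cancel]

theorem divCoeff_toVec (hβ : β ≠ -1) {u : Superfn} (hu : u ∈ divFree β) :
    divCoeff β (toVec u) = u {2} := by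
  have hdiv : vdiv (toVec u) = (2 * (β + 1)) • u {2} := by
    have h := (divb_apply β u).1
    rw [show divb β u = 0 from hu, Pi.zero_apply] at h
    simp only [vdiv_apply, toVec_apply, xi_zero, xi_one, tau_eq_two, map_add,
      Derivation.leibniz, smul_eq_mul, MvPowerSeries.pderiv_X_self, eulerA_apply,
      MvPowerSeries.smul_eq_C_mul, map_mul, map_ofNat, map_one] at h ⊢
    linear_combination -h
  rw [divCoeff, hdiv, inv_smul_smul₀]
  exact mul_ne_zero two_ne_zero (mt eq_neg_of_add_eq_zero_left hβ)

theorem apply_univ_eq_zero (hβ : β ≠ 1) {u : Superfn} (hu : u ∈ divFree β) : u {0, 1, 2} = 0 := by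
  obtain ⟨-, -, -, -, h01, h02, h12, -⟩ := divb_apply β u
  rw [show divb β u = 0 from hu] at h01 h02 h12
  refine ext_pderiv ?_ ?_ ?_
  · rw [map_zero, ← h12, Pi.zero_apply]
  · rw [map_zero, ← neg_eq_zero, ← h02, Pi.zero_apply]
  · have hc := congrArg constantCoeff h01
    simp only [Pi.zero_apply, map_add, map_sub, constantCoeff_eulerA, MvPowerSeries.smul_eq_C_mul,
      map_mul, MvPowerSeries.constantCoeff_C, map_ofNat, map_zero] at hc
    have h2 : 2 * (1 - β) ≠ 0 := mul_ne_zero two_ne_zero (sub_ne_zero.mpr hβ.symm)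
    rw [map_zero]
    exact (mul_eq_zero.mp (by linear_combination -hc)).resolve_left h2

/-- For `β = 0` the constant term of the coefficient of `ξ₁ξ₂` is an obstruction; it vanishes on
the derived algebra. -/
theorem exists_degree_one_potential {u : Superfn} (hu : u ∈ divFree β)
    (h0 : β = 0 → constantCoeff (u {0, 1}) = 0) :
    ∃ h : A, u {0, 1} = eulerA h - (2 * β) • h ∧ u {0, 2} = -pderiv ℂ 1 h ∧
      u {1, 2} = pderiv ℂ 0 h := by
  obtain ⟨-, d0, d1, d2, -⟩ := divb_apply β u
  rw [show divb β u = 0 from hu, Pi.zero_apply] at d0 d1 d2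
  obtain ⟨φ, hφ1, hφ0⟩ := exists_hamiltonian d2.symm
  obtain ⟨h, hh1, hh0, hc⟩ : ∃ h : A, pderiv ℂ 1 h = pderiv ℂ 1 φ ∧ pderiv ℂ 0 h = pderiv ℂ 0 φ ∧
      constantCoeff h = -constantCoeff (u {0, 1}) / (2 * β) :=
    ⟨φ + C (-constantCoeff (u {0, 1}) / (2 * β) - constantCoeff φ), by simp, by simp, by simp⟩
  rw [← hh1] at hφ1
  rw [← hh0] at hφ0
  refine ⟨h, ext_pderiv ?_ ?_ ?_, hφ1, hφ0⟩
  · rw [map_sub, pderiv_eulerA, Derivation.map_smul, ← hφ0]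
    linear_combination -d1
  · rw [map_sub, pderiv_eulerA, Derivation.map_smul]
    rw [hφ1, smul_neg, eulerA_eq_dirDeriv, map_neg, ← eulerA_eq_dirDeriv] at d0
    linear_combination d0
  · rw [map_sub, constantCoeff_eulerA, MvPowerSeries.constantCoeff_smul, hc, smul_eq_mul,
      mul_div_cancel_of_imp' (by simpa using h0), zero_sub, neg_neg]

theorem exists_eq_emb (hβ : β ≠ 1) (hβ' : β ≠ -1) {u : Superfn} (hu : u ∈ divFree β)
    (h0 : β = 0 → constantCoeff (u {0, 1}) = 0) : ∃ p, emb β p = u := by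
  obtain ⟨h, h01, h02, h12⟩ := exists_degree_one_potential hu h0
  refine ⟨(u ∅, toVec u, h), ?_⟩
  apply superfn_ext <;>
    simp only [emb_apply, divCoeff_toVec hβ' hu, apply_univ_eq_zero hβ hu, h01, h02, h12,
      toVec_apply, xi_zero, xi_one, tau_eq_two, add_sub_cancel_right]

end DivFree

section DerivedAlgebra

variable {β : ℂ}

theorem pairing_zero_left (h : A) : pairing β 0 h = 0 := by
  ext1 i
  fin_cases i <;> simp [pairing]

theorem pairing_zero_right (a : A) : pairing β a 0 = 0 := by
  ext1 i
  fin_cases i <;> simp [pairing]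

theorem emb_mem_SKO (hβ : β ≠ -1) (p : Coords) : emb β p ∈ SKO β := by
  choose I hI using exists_pderiv_zero_eq
  have hdir (f : A) : dirDeriv ![1, 0] f = pderiv ℂ 0 f := by simp [dirDeriv_apply]
  have hdiv : vdiv ![1, 0] = 0 := by simp [vdiv_apply]
  -- `p` is the bracket of `∂/∂x₁` with an antiderivative of `p` in the direction `x₁`
  refine Submodule.subset_span ⟨_, emb_mem_divFree hβ (0, ![1, 0], 0), _,
    emb_mem_divFree hβ (I p.1, fun i => I (p.2.1 i), I p.2.2), ?_⟩
  rw [bracket_emb hβ]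
  congr 1
  refine Prod.ext ?_ (Prod.ext (funext fun i => ?_) ?_)
  · simp [coordBracket, act, hdir, hdiv, hI]
  · have h (i : Fin 2) (V : VecField) : dirDeriv V ((![1, 0] : VecField) i) = 0 := by
      fin_cases i <;> simp
    simp [coordBracket, vbracket, pairing_zero_left, pairing_zero_right, hdir, hI, h]
  · simp [coordBracket, act, hdir, hdiv, hI]

theorem constantCoeff_of_mem_divFree_zero {u : Superfn} (hu : u ∈ divFree 0) :
    constantCoeff (pderiv ℂ 0 (u {0})) + constantCoeff (pderiv ℂ 1 (u {1})) = 0 ∧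
    constantCoeff (pderiv ℂ 1 (u {0, 1})) = -constantCoeff (u {0, 2}) ∧
    constantCoeff (pderiv ℂ 0 (u {0, 1})) = constantCoeff (u {1, 2}) ∧
    constantCoeff (u {0, 1, 2}) = 0 := by
  obtain ⟨de, d0, d1, -, d01, -⟩ := divb_apply 0 u
  rw [show divb 0 u = 0 from hu] at de d0 d1 d01
  replace de := congrArg constantCoeff de
  replace d0 := congrArg constantCoeff d0
  replace d1 := congrArg constantCoeff d1
  replace d01 := congrArg constantCoeff d01
  simp only [mul_zero, zero_smul, sub_zero, Pi.zero_apply, map_add, map_sub, map_neg, map_mul,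
    constantCoeff_eulerA, map_zero, map_ofNat] at de d0 d1 d01
  refine ⟨?_, ?_, ?_, ?_⟩
  · linear_combination -de
  · linear_combination d0
  · linear_combination -d1
  · linear_combination -d01 / 2

theorem constantCoeff_bracket_eq_zero {u w : Superfn} (hu : u ∈ divFree 0) (hw : w ∈ divFree 0) :
    constantCoeff (bracket u w {0, 1}) = 0 := by
  obtain ⟨ue, u0, u1, u01⟩ := constantCoeff_of_mem_divFree_zero hu
  obtain ⟨we, w0, w1, w01⟩ := constantCoeff_of_mem_divFree_zero hw
  have hn (n : ℕ) (a : A) : n • a = (n : A) * a := nsmul_eq_mul n a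
  have hz (n : ℤ) (a : A) : n • a = (n : A) * a := zsmul_eq_mul a n
  simp only [bracket, xi_zero, xi_one, tau_eq_two, Fin.sum_univ_two, Pi.add_apply, Pi.sub_apply,
    Pi.smul_apply, dEven, dOdd_0, dOdd_1, dOdd_2, euler_apply, card_vals, sprod_01, par,
    Finset.card_singleton, map_add, map_sub, map_neg, map_mul, hn, hz,
    MvPowerSeries.constantCoeff_X, map_natCast, map_intCast, map_zero]
  push_cast
  set cc := constantCoeff (σ := Fin 2) (R := ℂ)
  linear_combination cc (u {0}) * w1 + cc (u {1}) * w0 + 2 * cc (u ∅) * w01 - 2 * cc (w ∅) * u01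
    - cc (w {1}) * u0 - cc (w {0}) * u1 - cc (w {0, 1}) * ue + cc (u {0, 1}) * we

theorem constantCoeff_eq_zero_of_mem_SKO_zero {u : Superfn} (hu : u ∈ SKO 0) :
    constantCoeff (u {0, 1}) = 0 := by
  induction hu using Submodule.span_induction with
  | mem x hx =>
    obtain ⟨f, hf, g, hg, rfl⟩ := hx
    exact constantCoeff_bracket_eq_zero hf hg
  | zero => exact map_zero _
  | add x y _ _ hx hy => rw [Pi.add_apply, map_add, hx, hy, add_zero]
  | smul c x _ hx => rw [Pi.smul_apply, MvPowerSeries.constantCoeff_smul, hx, smul_zero]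

/-- The parametrization of `SKO(2,3;β)` by coordinates. -/
def embSKO (hβ : β ≠ -1) : Coords →ₗ[ℂ] SKO β where
  toFun p := ⟨emb β p, emb_mem_SKO hβ p⟩
  map_add' p q := Subtype.ext (emb_add p q)
  map_smul' c p := Subtype.ext (emb_smul c p)

theorem coe_embSKO (hβ : β ≠ -1) (p : Coords) : (embSKO hβ p : Superfn) = emb β p := rfl

theorem skoBracket_embSKO (hβ : β ≠ -1) (p q : Coords) :
    skoBracket (embSKO hβ p) (embSKO hβ q) = embSKO hβ (coordBracket β p q) :=
  Subtype.ext (bracket_emb hβ p q)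

theorem embSKO_surjective (hβ : β ≠ 1) (hβ' : β ≠ -1) : Function.Surjective (embSKO hβ') := by
  intro u
  obtain ⟨p, hp⟩ := exists_eq_emb hβ hβ' (SKO_le_divFree β u.2) (by
    rintro rfl
    exact constantCoeff_eq_zero_of_mem_SKO_zero u.2)
  exact ⟨p, Subtype.ext hp⟩

theorem embSKO_injective (hβ : β ≠ 0) (hβ' : β ≠ -1) : Function.Injective (embSKO hβ') := by
  rw [injective_iff_map_eq_zero]
  intro p hp
  replace hp : emb β p = 0 := congrArg Subtype.val hp
  obtain ⟨he, -, -, -, h01, h02, h12, -⟩ := emb_apply β p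
  rw [hp, Pi.zero_apply] at he h01 h02 h12
  have hV : p.2.1 = 0 := by rw [← toVec_emb (β := β) p, hp, map_zero]
  have hh : p.2.2 = 0 := by
    refine ext_pderiv (by rw [← h12, map_zero]) (by rw [map_zero, ← neg_eq_zero, ← h02]) ?_
    have hc := congrArg constantCoeff h01
    rw [map_zero, map_sub, constantCoeff_eulerA, MvPowerSeries.constantCoeff_smul, zero_sub,
      zero_eq_neg, smul_eq_zero] at hc
    rw [map_zero]
    exact hc.resolve_left (mul_ne_zero two_ne_zero hβ)
  exact Prod.ext he.symm (Prod.ext hV hh)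

/-- The coordinates on `SKO(2,3;β)`. For `β = 0` they are not unique, since `ofPos 0` kills the
constants. -/
def embEquiv (hβ₀ : β ≠ 0) (hβ : β ≠ 1) (hβ' : β ≠ -1) : Coords ≃ₗ[ℂ] SKO β :=
  LinearEquiv.ofBijective (embSKO hβ') ⟨embSKO_injective hβ₀ hβ', embSKO_surjective hβ hβ'⟩

/-- The degree `j` component in coordinates. -/
def coordGrade (j : ℤ) : Set Coords :=
  {p | (j ≠ -1 → p.1 = 0) ∧ (j ≠ 0 → p.2.1 = 0) ∧ (j ≠ 1 → p.2.2 = 0)}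

theorem embSKO_mem_grade (hβ' : β ≠ -1) {j : ℤ} {p : Coords} (hp : p ∈ coordGrade j) :
    embSKO hβ' p ∈ grade β j := by
  obtain ⟨hf, hV, hh⟩ := hp
  intro S hS
  have hdiv : divCoeff β 0 = 0 := by simp [divCoeff, vdiv_apply]
  rw [coe_embSKO]
  obtain rfl | rfl | rfl | rfl | rfl | rfl | rfl | rfl := finset3 S <;>
    simp only [emb_apply, Finset.card_empty, Finset.card_singleton, card_vals] at hS ⊢
  · exact hf (by grind)
  · rw [hV (by grind), hdiv]; simp
  · rw [hV (by grind), hdiv]; simp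
  · rw [hV (by grind), hdiv]
  · rw [hh (by grind), eulerA_eq_dirDeriv]; simp
  · rw [hh (by grind), map_zero, neg_zero]
  · rw [hh (by grind), map_zero]

theorem mem_grade_iff (hβ : β ≠ 1) (hβ' : β ≠ -1) {j : ℤ} {u : SKO β} :
    u ∈ grade β j ↔ ∃ p ∈ coordGrade j, embSKO hβ' p = u := by
  refine ⟨fun hu => ?_, fun ⟨p, hp, hpu⟩ => hpu ▸ embSKO_mem_grade hβ' hp⟩
  obtain ⟨⟨f, V, h⟩, rfl⟩ := embSKO_surjective hβ hβ' u
  have hzero (S : Finset (Fin 3)) (n : ℕ) (hS : S.card = n) (hn : (n : ℤ) ≠ j + 1) :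
      emb β (f, V, h) S = 0 := hu S (by rwa [hS])
  have hf (hj : j ≠ -1) : f = 0 := by
    rw [← hzero ∅ 0 rfl (by grind), (emb_apply β _).1]
  have hV (hj : j ≠ 0) : V = 0 := by
    rw [← show toVec (emb β (f, V, h)) = V from toVec_emb _]
    ext1 i
    rw [toVec_apply, hzero {xi i} 1 rfl (by grind), hzero {tau} 1 rfl (by grind), mul_zero,
      add_zero, Pi.zero_apply]
  refine ⟨(f, V, if j = 1 then h else 0), ⟨hf, hV, fun hj => if_neg hj⟩, Subtype.ext ?_⟩
  split_ifs with hj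
  · rfl
  · have h01 := hzero {0, 1} 2 rfl (by grind)
    have h02 := hzero {0, 2} 2 rfl (by grind)
    have h12 := hzero {1, 2} 2 rfl (by grind)
    simp only [emb_apply] at h01 h02 h12
    simp only [coe_embSKO]
    apply superfn_ext <;> simp only [emb_apply, h01, h02, h12] <;> simp [eulerA_apply]

end DerivedAlgebra

section Conjugation

variable {β c : ℂ}

theorem conjA_zero : conjA 0 = 0 := map_zero _

theorem conjA_add (a b : A) : conjA (a + b) = conjA a + conjA b := map_add _ a b

theorem conjA_neg (a : A) : conjA (-a) = -conjA a := map_neg _ a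

theorem conjA_sub (a b : A) : conjA (a - b) = conjA a - conjA b := map_sub _ a b

theorem conjA_mul (a b : A) : conjA (a * b) = conjA a * conjA b := map_mul _ a b

theorem conjA_smul (t : ℂ) (a : A) : conjA (t • a) = conj t • conjA a := by
  simp [conjA, MvPowerSeries.smul_eq_C_mul]

theorem conjA_conjA (a : A) : conjA (conjA a) = a := by
  ext n
  simp [conjA]

theorem conjA_pderiv (i : Fin 2) (a : A) : conjA (pderiv ℂ i a) = pderiv ℂ i (conjA a) := by
  ext n
  simp [conjA, MvPowerSeries.coeff_pderiv]

theorem conjA_dirDeriv (V : VecField) (f : A) :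
    conjA (dirDeriv V f) = dirDeriv (fun i => conjA (V i)) (conjA f) := by
  simp only [dirDeriv_apply, conjA_add, conjA_mul, conjA_pderiv]

theorem conjA_act (l : ℂ) (V : VecField) (f : A) :
    conjA (act l V f) = act (conj l) (fun i => conjA (V i)) (conjA f) := by
  simp only [act, vdiv_apply, conjA_add, conjA_smul, conjA_mul, conjA_pderiv, conjA_dirDeriv]

theorem act_smul (l t : ℂ) (V : VecField) (f : A) : act l V (t • f) = t • act l V f := by
  rw [act, act, Derivation.map_smul, mul_smul_comm, smul_comm l, smul_add]

theorem mul_conj_eq_one_of_sq_eq_conj (hn : ‖β‖ = 1) (hc : c ^ 2 = conj β) : c * conj c = 1 := by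
  have h := congrArg norm hc
  rw [norm_pow, RCLike.norm_conj, hn] at h
  exact (mul_conj_eq_one_iff c).mpr ((pow_eq_one_iff_of_nonneg (norm_nonneg c) two_ne_zero).mp h)

theorem conjA_pairing (hn : ‖β‖ = 1) (hc : c ^ 2 = conj β) (a h : A) (i : Fin 2) :
    conjA (pairing β a h i) = pairing β (-c • conjA h) (c • conjA a) i := by
  have htwo : conjA 2 = 2 := map_ofNat _ 2
  have hβc : (C β * C c ^ 2 : A) = 1 := by
    rw [← map_pow, hc, ← map_mul, (mul_conj_eq_one_iff β).mpr hn, map_one]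
  have hC : (C (conj β) : A) = C c ^ 2 := by rw [← map_pow, hc]
  fin_cases i <;>
    simp only [pairing, Fin.zero_eta, Fin.mk_one, Matrix.cons_val_zero, Matrix.cons_val_one,
      conjA_sub, conjA_mul, conjA_smul, conjA_pderiv, Derivation.map_smul, htwo] <;>
    simp only [map_mul, map_ofNat, MvPowerSeries.smul_eq_C_mul, map_neg, hC]
  · linear_combination -2 * conjA a * pderiv ℂ 1 (conjA h) * hβc
  · linear_combination 2 * conjA a * pderiv ℂ 0 (conjA h) * hβc

/-- The conjugation `σ` of `SKO(2,3;β)` in coordinates, where `fw` is `c • ofPos β f`. -/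
def coordConj (hc : c * conj c = 1) : Coords ≃ₛₗ[starRingEnd ℂ] Coords where
  toFun p := (-c • conjA p.2.2, fun i => conjA (p.2.1 i), c • conjA p.1)
  invFun p := (c • conjA p.2.2, fun i => conjA (p.2.1 i), -c • conjA p.1)
  map_add' p q := by
    ext1
    · simp [conjA_add]
    ext1
    · funext i; simp [conjA_add]
    · simp [conjA_add]
  map_smul' a p := by
    ext1
    · simp [conjA_smul, smul_smul, mul_comm]
    ext1
    · funext i; simp [conjA_smul]
    · simp [conjA_smul, smul_smul, mul_comm]
  left_inv p := by simp [conjA_smul, conjA_conjA, smul_smul, hc, conjA_neg]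
  right_inv p := by simp [conjA_smul, conjA_conjA, smul_smul, hc, conjA_neg]

theorem coordConj_apply (hc : c * conj c = 1) (p : Coords) :
    coordConj hc p = (-c • conjA p.2.2, fun i => conjA (p.2.1 i), c • conjA p.1) := rfl

theorem coordConj_coordConj (hc : c * conj c = 1) (p : Coords) :
    coordConj hc (coordConj hc p) = (-p.1, p.2.1, -p.2.2) := by
  simp [coordConj_apply, conjA_neg, conjA_smul, conjA_conjA, smul_smul, hc]

theorem coordConj_coordBracket (hβ' : β ≠ -1) (hn : ‖β‖ = 1) (hc : c ^ 2 = conj β)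
    (hc' : c * conj c = 1) (p q : Coords) : coordConj hc' (coordBracket β p q) =
      coordBracket β (coordConj hc' p) (coordConj hc' q) := by
  have hneg : conj (negWeight β) = posWeight β := (conj_negWeight_eq_posWeight_iff hβ').mpr hn
  have hpos : conj (posWeight β) = negWeight β := by rw [← hneg, Complex.conj_conj]
  simp only [coordConj_apply, coordBracket]
  refine Prod.ext ?_ (Prod.ext (funext fun i => ?_) ?_)
  · simp only [conjA_sub, conjA_act, act_smul, hpos, smul_sub]
  · simp only [Pi.add_apply, conjA_add, conjA_pairing hn hc, vbracket, conjA_sub, conjA_dirDeriv]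
    ring
  · simp only [conjA_sub, conjA_act, act_smul, hneg, smul_sub]

theorem coordConj_mem_coordGrade (hc : c * conj c = 1) {j : ℤ} {p : Coords}
    (hp : p ∈ coordGrade j) : coordConj hc p ∈ coordGrade (-j) := by
  obtain ⟨hf, hV, hh⟩ := hp
  refine ⟨fun hj => ?_, fun hj => funext fun i => ?_, fun hj => ?_⟩ <;> rw [coordConj_apply]
  · simp [hh (by grind), conjA_zero]
  · simp [hV (by grind), conjA_zero]
  · simp [hf (by grind), conjA_zero]

theorem coordConj_coordConj_of_mem_coordGrade (hc : c * conj c = 1) {j : ℤ} {p : Coords}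
    (hp : p ∈ coordGrade j) : coordConj hc (coordConj hc p) = (-1 : ℂ) ^ j • p := by
  obtain ⟨hf, hV, hh⟩ := hp
  rw [coordConj_coordConj]
  refine Prod.ext ?_ (Prod.ext ?_ ?_)
  · obtain rfl | hj := eq_or_ne j (-1)
    · simp
    · simp [hf hj]
  · obtain rfl | hj := eq_or_ne j 0
    · simp
    · simp [hV hj]
  · obtain rfl | hj := eq_or_ne j 1
    · simp
    · simp [hh hj]

/-- The graded conjugation of the theorem, as a semilinear automorphism. -/
def gradedConj (hβ₀ : β ≠ 0) (hβ : β ≠ 1) (hβ' : β ≠ -1) (hc : c * conj c = 1) :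
    SKO β ≃ₛₗ[starRingEnd ℂ] SKO β :=
  ((embEquiv hβ₀ hβ hβ').symm.trans (coordConj hc)).trans (embEquiv hβ₀ hβ hβ')

theorem gradedConj_embSKO (hβ₀ : β ≠ 0) (hβ : β ≠ 1) (hβ' : β ≠ -1) (hc : c * conj c = 1)
    (p : Coords) :
    gradedConj hβ₀ hβ hβ' hc (embSKO hβ' p) = embSKO hβ' (coordConj hc p) :=
  congrArg (fun q => embSKO hβ' (coordConj hc q)) ((embEquiv hβ₀ hβ hβ').symm_apply_apply p)

theorem isGradedConj_gradedConj (hβ₀ : β ≠ 0) (hβ : β ≠ 1) (hβ' : β ≠ -1) (hn : ‖β‖ = 1)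
    (hc : c ^ 2 = conj β) (hc' : c * conj c = 1) :
    IsGradedConj β (gradedConj hβ₀ hβ hβ' hc') := by
  have hgrade (j : ℤ) (u) (hu : u ∈ grade β j) : gradedConj hβ₀ hβ hβ' hc' u ∈ grade β (-j) := by
    obtain ⟨p, hp, rfl⟩ := (mem_grade_iff hβ hβ').mp hu
    rw [gradedConj_embSKO]
    exact embSKO_mem_grade hβ' (coordConj_mem_coordGrade hc' hp)
  have hsq (j : ℤ) (u) (hu : u ∈ grade β j) :
      gradedConj hβ₀ hβ hβ' hc' (gradedConj hβ₀ hβ hβ' hc' u) = (-1 : ℂ) ^ j • u := by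
    obtain ⟨p, hp, rfl⟩ := (mem_grade_iff hβ hβ').mp hu
    rw [gradedConj_embSKO, gradedConj_embSKO, coordConj_coordConj_of_mem_coordGrade hc' hp,
      map_smul]
  refine ⟨fun u w => ?_, fun j => Set.Subset.antisymm ?_ fun w hw => ?_, hsq⟩
  · obtain ⟨p, rfl⟩ := embSKO_surjective hβ hβ' u
    obtain ⟨q, rfl⟩ := embSKO_surjective hβ hβ' w
    simp only [skoBracket_embSKO, gradedConj_embSKO, coordConj_coordBracket hβ' hn hc]
  · rintro - ⟨u, hu, rfl⟩
    exact hgrade j u hu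
  · refine ⟨(-1 : ℂ) ^ j • gradedConj hβ₀ hβ hβ' hc' w, fun S hS => ?_, ?_⟩
    · have h := hgrade _ w hw S (by rwa [neg_neg])
      rw [Submodule.coe_smul, Pi.smul_apply, h, smul_zero]
    · rw [map_smulₛₗ, hsq _ w hw, smul_smul]
      simp [mul_inv_cancel₀ (zpow_ne_zero j (neg_ne_zero.mpr (one_ne_zero (α := ℂ))))]

theorem ofNeg_eq_emb (β : ℂ) (f : A) : ofNeg f = emb β (f, 0, 0) := by
  simp [emb, ofVec, ofPos, mono, vdiv, eulerA]

theorem ofVec_eq_emb (β : ℂ) (V : VecField) : ofVec β V = emb β (0, V, 0) := by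
  simp [emb, ofNeg, ofPos, mono, eulerA]

theorem ofPos_eq_emb (β : ℂ) (h : A) : ofPos β h = emb β (0, 0, h) := by
  simp [emb, ofNeg, ofVec, mono, vdiv]

theorem exists_coe_eq_emb_iff (hβ' : β ≠ -1) {σ : SKO β ≃ₛₗ[starRingEnd ℂ] SKO β}
    {p q : Coords} : (∃ u : SKO β, (u : Superfn) = emb β p ∧ (σ u : Superfn) = emb β q) ↔
      σ (embSKO hβ' p) = embSKO hβ' q := by
  refine ⟨fun ⟨u, hu, hσu⟩ => ?_, fun h => ⟨embSKO hβ' p, rfl, congrArg Subtype.val h⟩⟩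
  rw [show embSKO hβ' p = u from Subtype.ext hu.symm]
  exact Subtype.ext hσu

theorem explicit_iff (hβ' : β ≠ -1) (hc : c * conj c = 1)
    (σ : SKO β ≃ₛₗ[starRingEnd ℂ] SKO β) :
    ((∀ V : VecField, ∃ u : SKO β, (u : Superfn) = ofVec β V ∧
        (σ u : Superfn) = ofVec β (fun i => conjA (V i))) ∧
      (∀ f : A, ∃ u : SKO β, (u : Superfn) = ofNeg f ∧
        (σ u : Superfn) = c • ofPos β (conjA f)) ∧
      ∀ f : A, ∃ u : SKO β, (u : Superfn) = c • ofPos β f ∧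
        (σ u : Superfn) = -ofNeg (conjA f)) ↔
    ∀ p, σ (embSKO hβ' p) = embSKO hβ' (coordConj hc p) := by
  simp only [ofNeg_eq_emb β, ofVec_eq_emb, ofPos_eq_emb, ← emb_smul, ← neg_one_smul ℂ (emb _ _),
    exists_coe_eq_emb_iff hβ']
  refine ⟨fun ⟨hvec, hneg, hpos⟩ p => ?_, fun h => ⟨fun V => ?_, fun f => ?_, fun f => ?_⟩⟩
  · have hsum : p = (0, p.2.1, 0) + (p.1, 0, 0) + c • (0, 0, conj c • p.2.2) := by
      refine Prod.ext ?_ (Prod.ext ?_ ?_) <;> simp [smul_smul, hc]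
    conv_lhs => rw [hsum, map_add, map_add, map_add, map_add, hvec, hneg, hpos]
    rw [← map_add, ← map_add, coordConj_apply]
    congr 1
    simp [conjA_smul]
  · simp [h, coordConj_apply, conjA_zero]
  · simp [h, coordConj_apply, conjA_zero, ← Pi.zero_def]
  · simp [h, coordConj_apply, conjA_zero, conjA_smul, smul_smul, hc, ← Pi.zero_def]

theorem existsUnique_isGradedConj (hβ : β ≠ 1) (hβ' : β ≠ -1) (hn : ‖β‖ = 1)
    (hc : c ^ 2 = conj β) : ∃! σ : SKO β ≃ₛₗ[starRingEnd ℂ] SKO β,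
      IsGradedConj β σ ∧
      (∀ V : VecField, ∃ u : SKO β, (u : Superfn) = ofVec β V ∧
        (σ u : Superfn) = ofVec β (fun i => conjA (V i))) ∧
      (∀ f : A, ∃ u : SKO β, (u : Superfn) = ofNeg f ∧
        (σ u : Superfn) = c • ofPos β (conjA f)) ∧
      (∀ f : A, ∃ u : SKO β, (u : Superfn) = c • ofPos β f ∧
        (σ u : Superfn) = -ofNeg (conjA f)) := by
  have hβ₀ : β ≠ 0 := norm_ne_zero_iff.mp (hn ▸ one_ne_zero)
  have hc' := mul_conj_eq_one_of_sq_eq_conj hn hc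
  simp only [explicit_iff hβ' hc']
  refine ⟨gradedConj hβ₀ hβ hβ' hc', ⟨isGradedConj_gradedConj hβ₀ hβ hβ' hn hc hc',
    gradedConj_embSKO hβ₀ hβ hβ' hc'⟩, fun ρ ⟨_, hρ⟩ => LinearEquiv.ext fun u => ?_⟩
  obtain ⟨p, rfl⟩ := embSKO_surjective hβ hβ' u
  rw [hρ, gradedConj_embSKO]

end Conjugation

section Frames

theorem vbracket_add_left (V₁ V₂ W : VecField) :
    vbracket (V₁ + V₂) W = vbracket V₁ W + vbracket V₂ W := by
  ext1 i
  simp only [vbracket, dirDeriv_apply, Pi.add_apply, map_add]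
  ring

theorem vbracket_smul_left (p : A) (V W : VecField) :
    vbracket (p • V) W = p • vbracket V W - dirDeriv W p • V := by
  ext1 i
  simp only [vbracket, dirDeriv_apply, Pi.sub_apply, Pi.smul_apply, Derivation.leibniz,
    smul_eq_mul]
  ring

theorem vbracket_smul_right (p : A) (V W : VecField) :
    vbracket V (p • W) = p • vbracket V W + dirDeriv V p • W := by
  ext1 i
  simp only [vbracket, dirDeriv_apply, Pi.add_apply, Pi.smul_apply, Derivation.leibniz,
    smul_eq_mul]
  ring

theorem vbracket_self (V : VecField) : vbracket V V = 0 := funext fun _ => sub_self _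

theorem vbracket_swap (V W : VecField) : vbracket V W = -vbracket W V :=
  funext fun _ => (neg_sub _ _).symm

theorem vdiv_add_smul (p q : A) (V W : VecField) : vdiv (p • V + q • W) =
    dirDeriv V p + dirDeriv W q + p * vdiv V + q * vdiv W := by
  simp only [vdiv_apply, dirDeriv_apply, Pi.add_apply, Pi.smul_apply, map_add, Derivation.leibniz,
    smul_eq_mul]
  ring

/-- The coefficient of `V ∧ W`; the two vector fields form a frame at the origin if its constant
term does not vanish. -/
def wedge (V W : VecField) : A := V 0 * W 1 - V 1 * W 0

theorem wedge_swap (V W : VecField) : wedge V W = -wedge W V := by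
  simp only [wedge]
  ring

theorem eq_zero_of_smul_add_smul_eq_zero {V W : VecField} (hVW : constantCoeff (wedge V W) ≠ 0)
    {a b : A} (h : a • V + b • W = 0) : a = 0 ∧ b = 0 := by
  have hwedge : wedge V W ≠ 0 := fun h0 => hVW (by rw [h0, map_zero])
  have h0 := congrFun h 0
  have h1 := congrFun h 1
  simp only [Pi.add_apply, Pi.smul_apply, smul_eq_mul, Pi.zero_apply] at h0 h1
  constructor <;> refine (mul_eq_zero.mp ?_).resolve_right hwedge <;> rw [wedge]
  · linear_combination W 1 * h0 - W 0 * h1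
  · linear_combination V 0 * h1 - V 1 * h0

theorem exists_eq_smul_add_smul {V W : VecField} (hVW : constantCoeff (wedge V W) ≠ 0)
    (E : VecField) : ∃ p q : A, E = p • V + q • W := by
  have hinv := MvPowerSeries.mul_inv_cancel _ hVW
  refine ⟨(wedge V W)⁻¹ * wedge E W, (wedge V W)⁻¹ * wedge V E, funext fun i => ?_⟩
  set d := (wedge V W)⁻¹
  rw [wedge] at hinv
  fin_cases i <;>
    simp only [Fin.zero_eta, Fin.mk_one, Pi.add_apply, Pi.smul_apply, smul_eq_mul, wedge]
  · linear_combination -E 0 * hinv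
  · linear_combination -E 1 * hinv

variable {E V W : VecField} {p q : A}

theorem dirDeriv_frame_coeff (hVW : constantCoeff (wedge V W) ≠ 0) (hE : E = p • V + q • W)
    (hEV : vbracket E V = -V) (hcomm : vbracket V W = 0) :
    dirDeriv V p = 1 ∧ dirDeriv V q = 0 := by
  rw [hE, vbracket_add_left, vbracket_smul_left, vbracket_smul_left, vbracket_self,
    vbracket_swap W V, hcomm] at hEV
  simp only [smul_zero, neg_zero, zero_sub] at hEV
  obtain ⟨hp, hq⟩ := eq_zero_of_smul_add_smul_eq_zero (a := 1 - dirDeriv V p)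
    (b := -dirDeriv V q) hVW (by
      rw [sub_smul, one_smul, neg_smul, sub_eq_add_neg, add_assoc, hEV, add_neg_cancel])
  exact ⟨(sub_eq_zero.mp hp).symm, neg_eq_zero.mp hq⟩

/-- If `p` were invertible, then `p⁻¹ V` would be an eigenvector of `[E, ·]` of weight `-2`. -/
theorem constantCoeff_frame_coeff_eq_zero (hVW : constantCoeff (wedge V W) ≠ 0)
    (hE : E = p • V + q • W) (hEV : vbracket E V = -V) (hVp : dirDeriv V p = 1)
    (hWp : dirDeriv W p = 0) (hno : ∀ U, vbracket E U = -(2 : ℂ) • U → U = 0) :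
    constantCoeff p = 0 := by
  by_contra hp
  have hinv : p * p⁻¹ = 1 := MvPowerSeries.mul_inv_cancel p hp
  have hEp : dirDeriv E p = p := by
    rw [dirDeriv_apply] at hVp hWp ⊢
    simp only [hE, Pi.add_apply, Pi.smul_apply, smul_eq_mul]
    linear_combination p * hVp + q * hWp
  have hEinv : dirDeriv E p⁻¹ = -p⁻¹ := by
    rw [Derivation.leibniz_of_mul_eq_one _ (mul_comm p p⁻¹ ▸ hinv), hEp, smul_eq_mul]
    linear_combination -p⁻¹ * hinv
  have hU := hno (p⁻¹ • V) (by
    rw [vbracket_smul_right, hEV, hEinv, smul_neg, neg_smul, neg_smul, two_smul, neg_add])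
  have hV : V = 0 := by rw [← one_smul A V, ← hinv, mul_smul, hU, smul_zero]
  exact hVW (by simp [hV, wedge])

/-- `E` looks like the Euler vector field at the origin: it vanishes there and has
divergence `2`. -/
theorem constantCoeff_of_euler_like (hVW : constantCoeff (wedge V W) ≠ 0)
    (hEV : vbracket E V = -V) (hEW : vbracket E W = -W) (hcomm : vbracket V W = 0)
    (hno : ∀ U, vbracket E U = -(2 : ℂ) • U → U = 0) :
    (∀ i, constantCoeff (E i) = 0) ∧ constantCoeff (vdiv E) = 2 := by
  have hWV : constantCoeff (wedge W V) ≠ 0 := by rwa [wedge_swap, map_neg, neg_ne_zero]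
  have hcomm' : vbracket W V = 0 := by rw [vbracket_swap, hcomm, neg_zero]
  obtain ⟨p, q, hE⟩ := exists_eq_smul_add_smul hVW E
  have hE' : E = q • W + p • V := hE.trans (add_comm _ _)
  obtain ⟨hVp, hVq⟩ := dirDeriv_frame_coeff hVW hE hEV hcomm
  obtain ⟨hWq, hWp⟩ := dirDeriv_frame_coeff hWV hE' hEW hcomm'
  have hp := constantCoeff_frame_coeff_eq_zero hVW hE hEV hVp hWp hno
  have hq := constantCoeff_frame_coeff_eq_zero hWV hE' hEW hWq hVq hno
  constructor
  · intro i
    simp [hE, hp, hq]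
  · rw [hE, vdiv_add_smul, hVp, hWq]
    simp only [map_add, map_mul, map_one, hp, hq]
    norm_num

end Frames

section Densities

/-- The constant vector field with value `v`. -/
def constVec (v : Fin 2 → ℂ) : VecField := fun i => C (v i)

theorem vbracket_constVec (v w : Fin 2 → ℂ) : vbracket (constVec v) (constVec w) = 0 := by
  ext1 i
  simp [vbracket, constVec, dirDeriv_apply]

theorem vbracket_X (V : VecField) (i : Fin 2) : vbracket X V i = eulerA (V i) - V i := by
  rw [vbracket, ← eulerA_eq_dirDeriv, dirDeriv_apply]
  fin_cases i <;> simp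

theorem vbracket_X_constVec (v : Fin 2 → ℂ) : vbracket X (constVec v) = -constVec v := by
  ext1 i
  rw [vbracket_X]
  simp [constVec, eulerA_apply]

theorem eq_zero_of_vbracket_X_eq {V : VecField} (h : vbracket X V = -(2 : ℂ) • V) : V = 0 := by
  ext1 i
  refine eq_zero_of_eulerA_add_smul_eq_zero (t := 1) Nat.cast_add_one_ne_zero ?_
  have hi := congrFun h i
  rw [vbracket_X, Pi.smul_apply, neg_smul, two_smul] at hi
  rw [one_smul]
  linear_combination hi

theorem act_X (l : ℂ) (f : A) : act l X f = eulerA f + (2 * l) • f := by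
  simp only [act, ← eulerA_eq_dirDeriv, vdiv_apply, MvPowerSeries.pderiv_X_self,
    MvPowerSeries.smul_eq_C_mul, map_mul, map_ofNat]
  ring

theorem act_constVec (l : ℂ) (v : Fin 2 → ℂ) (f : A) :
    act l (constVec v) f = ∑ j, v j • pderiv ℂ j f := by
  simp [act, constVec, vdiv_apply, dirDeriv_apply, MvPowerSeries.smul_eq_C_mul, Fin.sum_univ_two]

theorem constantCoeff_act {V : VecField} (hV : ∀ i, constantCoeff (V i) = 0) (l : ℂ) (f : A) :
    constantCoeff (act l V f) = l * constantCoeff (vdiv V) * constantCoeff f := by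
  simp [act, dirDeriv_apply, hV, mul_assoc]

variable {s : VecField ≃ₛₗ[starRingEnd ℂ] VecField} {T : A →ₛₗ[starRingEnd ℂ] ℂ} {a b : ℂ}

theorem constantCoeff_wedge_ne_zero
    (hs : ∀ v : Fin 2 → ℂ, v ≠ 0 → ∃ i, constantCoeff (s (constVec v) i) ≠ 0) :
    constantCoeff (wedge (s (constVec ![1, 0])) (s (constVec ![0, 1]))) ≠ 0 := by
  set Y := s (constVec ![1, 0])
  set Z := s (constVec ![0, 1])
  let M : Matrix (Fin 2) (Fin 2) ℂ := Matrix.of ![fun i => constantCoeff (Y i),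
    fun i => constantCoeff (Z i)]
  intro hdet
  obtain ⟨v, hv, hvM⟩ := Matrix.exists_vecMul_eq_zero_iff (M := M).mpr (by
    simpa [M, Matrix.det_fin_two, wedge] using hdet)
  obtain ⟨i, hi⟩ := hs (fun i => conj (v i)) fun h => hv (funext fun i => by
    simpa using congrFun h i)
  have hsv : s (constVec fun i => conj (v i)) = v 0 • Y + v 1 • Z := by
    have hvec : constVec (fun i => conj (v i)) =
        conj (v 0) • constVec ![1, 0] + conj (v 1) • constVec ![0, 1] := by
      ext1 i
      fin_cases i <;> simp [constVec, MvPowerSeries.smul_eq_C_mul]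
    rw [hvec, map_add, map_smulₛₗ, map_smulₛₗ, Complex.conj_conj, Complex.conj_conj]
  refine hi ?_
  have hi := congrFun hvM i
  simpa [hsv, M, Matrix.vecMul, dotProduct, Fin.sum_univ_two] using hi

theorem exists_constantCoeff_ne_zero (hT₀ : T ≠ 0)
    (hT : ∀ V f, (∀ i, constantCoeff (s V i) = 0) →
      T (act a V f) = b * constantCoeff (vdiv (s V)) * T f)
    {v : Fin 2 → ℂ} (hv : v ≠ 0) : ∃ i, constantCoeff (s (constVec v) i) ≠ 0 := by
  by_contra! hzero
  refine hT₀ (LinearMap.ext fun g => ?_)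
  -- otherwise `T` is an eigenvector of `∂/∂v`, which is impossible as `∂/∂v - t` is surjective
  obtain ⟨f, rfl⟩ := exists_sum_smul_pderiv_sub_smul_eq hv
    (conj (b * constantCoeff (vdiv (s (constVec v))))) g
  rw [← act_constVec a, map_sub, hT _ _ hzero, map_smulₛₗ, Complex.conj_conj, smul_eq_mul,
    sub_self, LinearMap.zero_apply]

theorem constantCoeff_map_X (hs : ∀ V W, s (vbracket V W) = vbracket (s V) (s W))
    (hv : ∀ v : Fin 2 → ℂ, v ≠ 0 → ∃ i, constantCoeff (s (constVec v) i) ≠ 0) :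
    (∀ i, constantCoeff (s X i) = 0) ∧ constantCoeff (vdiv (s X)) = 2 := by
  refine constantCoeff_of_euler_like (constantCoeff_wedge_ne_zero hv) ?_ ?_ ?_ fun U hU => ?_
  · rw [← hs, vbracket_X_constVec, map_neg]
  · rw [← hs, vbracket_X_constVec, map_neg]
  · rw [← hs, vbracket_constVec, map_zero]
  · obtain ⟨V, rfl⟩ := s.surjective U
    rw [← hs, ← map_ofNat (starRingEnd ℂ) 2, ← map_neg, ← map_smulₛₗ] at hU
    rw [eq_zero_of_vbracket_X_eq (s.injective hU), map_zero]

theorem exists_natCast_add_weight_eq_zero (hs : ∀ V W, s (vbracket V W) = vbracket (s V) (s W))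
    (hT₀ : T ≠ 0) (hT : ∀ V f, (∀ i, constantCoeff (s V i) = 0) →
      T (act a V f) = b * constantCoeff (vdiv (s V)) * T f) :
    ∃ k : ℕ, (k : ℂ) + (2 * a - conj (b * 2)) = 0 := by
  obtain ⟨hX, hdiv⟩ := constantCoeff_map_X hs fun _ => exists_constantCoeff_ne_zero hT₀ hT
  by_contra! hk
  refine hT₀ (LinearMap.ext fun g => ?_)
  obtain ⟨f, rfl⟩ := exists_eulerA_add_smul_eq (t := 2 * a - conj (b * 2)) (g := g)
    fun n hn => absurd hn (hk n.degree)
  rw [sub_smul, ← add_sub_assoc, ← act_X, map_sub, hT _ _ hX, hdiv, map_smulₛₗ,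
    Complex.conj_conj, smul_eq_mul, sub_self, LinearMap.zero_apply]

end Densities

section Necessity

variable {β : ℂ} {σ : SKO β ≃ₛₗ[starRingEnd ℂ] SKO β}

theorem act_zero_right (l : ℂ) (V : VecField) : act l V 0 = 0 := by
  rw [act, map_zero, mul_zero, smul_zero, add_zero]

theorem vbracket_zero_right (V : VecField) : vbracket V 0 = 0 := by
  ext1 i
  simp [vbracket, dirDeriv_apply]

theorem skoBracket_ofVec_embSKO (hβ' : β ≠ -1) (V : VecField) (p : Coords) :
    skoBracket (embSKO hβ' (0, V, 0)) (embSKO hβ' p) =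
      embSKO hβ' (act (negWeight β) V p.1, vbracket V p.2.1, act (posWeight β) V p.2.2) := by
  rw [skoBracket_embSKO]
  simp only [coordBracket, act_zero_right, pairing_zero_left, pairing_zero_right, add_zero,
    sub_zero]

/-- The value at the origin of the coefficient of `θ_S`. -/
def valueAt (β : ℂ) (S : Finset (Fin 3)) : SKO β →ₗ[ℂ] ℂ where
  toFun u := constantCoeff ((u : Superfn) S)
  map_add' u w := by simp
  map_smul' t u := by simp

theorem valueAt_empty_embSKO (hβ' : β ≠ -1) (p : Coords) :
    valueAt β ∅ (embSKO hβ' p) = constantCoeff p.1 :=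
  congrArg constantCoeff (emb_apply β p).1

theorem valueAt_zero_one_embSKO (hβ' : β ≠ -1) (p : Coords) :
    valueAt β {0, 1} (embSKO hβ' p) = -(2 * β) * constantCoeff p.2.2 := by
  refine (congrArg constantCoeff (emb_apply β p).2.2.2.2.1).trans ?_
  rw [map_sub, constantCoeff_eulerA, MvPowerSeries.constantCoeff_smul, zero_sub, smul_eq_mul,
    neg_mul]

theorem IsGradedConj.exists_eq_embSKO (hσ : IsGradedConj β σ) (hβ : β ≠ 1) (hβ' : β ≠ -1) {j : ℤ}
    {p : Coords} (hp : p ∈ coordGrade j) :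
    ∃ q ∈ coordGrade (-j), σ (embSKO hβ' p) = embSKO hβ' q := by
  obtain ⟨q, hq, hpq⟩ := (mem_grade_iff hβ hβ').mp
    (hσ.map_grade j ▸ Set.mem_image_of_mem σ (embSKO_mem_grade hβ' hp))
  exact ⟨q, hq, hpq.symm⟩

theorem IsGradedConj.exists_map_embSKO_eq (hσ : IsGradedConj β σ) (hβ : β ≠ 1) (hβ' : β ≠ -1)
    {j : ℤ} {q : Coords} (hq : q ∈ coordGrade (-j)) :
    ∃ p ∈ coordGrade j, σ (embSKO hβ' p) = embSKO hβ' q := by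
  obtain ⟨u, hu, huq⟩ := (hσ.map_grade j).superset (embSKO_mem_grade hβ' hq)
  obtain ⟨p, hp, rfl⟩ := (mem_grade_iff hβ hβ').mp hu
  exact ⟨p, hp, huq⟩

theorem IsGradedConj.exists_vecField_equiv (hσ : IsGradedConj β σ) (hβ : β ≠ 1) (hβ' : β ≠ -1) :
    ∃ s : VecField ≃ₛₗ[starRingEnd ℂ] VecField,
      (∀ V, σ (embSKO hβ' (0, V, 0)) = embSKO hβ' (0, s V, 0)) ∧
      ∀ V W, s (vbracket V W) = vbracket (s V) (s W) := by
  let s : VecField →ₛₗ[starRingEnd ℂ] VecField := (toVec ∘ₗ (SKO β).subtype).comp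
    (σ.toLinearMap.comp (embSKO hβ' ∘ₗ LinearMap.inr ℂ A (VecField × A) ∘ₗ
      LinearMap.inl ℂ VecField A))
  have hmem (V : VecField) : ((0, V, 0) : Coords) ∈ coordGrade 0 := by simp [coordGrade]
  have htoVec (p : Coords) : toVec (embSKO hβ' p : Superfn) = p.2.1 := toVec_emb p
  have hs (V) : σ (embSKO hβ' (0, V, 0)) = embSKO hβ' (0, s V, 0) := by
    obtain ⟨⟨f, W, h⟩, ⟨hf, -, hh⟩, hW⟩ := hσ.exists_eq_embSKO hβ hβ' (hmem V)
    obtain rfl : f = 0 := hf (by decide)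
    obtain rfl : h = 0 := hh (by decide)
    have hsV : s V = W := (congrArg (fun u : SKO β => toVec (u : Superfn)) hW).trans (htoVec _)
    rw [hW, hsV]
  have hinj {V W : VecField} (h : embSKO hβ' (0, V, 0) = embSKO hβ' (0, W, 0)) : V = W := by
    simpa only [htoVec] using congrArg (fun u : SKO β => toVec (u : Superfn)) h
  refine ⟨LinearEquiv.ofInvolutive s fun V => hinj ?_, hs, fun V W => hinj ?_⟩
  · rw [← hs, ← hs, hσ.sq 0 _ (embSKO_mem_grade hβ' (hmem V)), zpow_zero, one_smul]
  · have h := hσ.map_bracket (embSKO hβ' (0, V, 0)) (embSKO hβ' (0, W, 0))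
    simp only [hs, skoBracket_ofVec_embSKO, act_zero_right] at h
    exact h

theorem IsGradedConj.exists_natCast_add_weight_eq_zero (hσ : IsGradedConj β σ) (hβ : β ≠ 1)
    (hβ' : β ≠ -1) {a b : ℂ} (i : A →ₗ[ℂ] SKO β) (e : SKO β →ₗ[ℂ] ℂ)
    (hi : ∀ V f, skoBracket (embSKO hβ' (0, V, 0)) (i f) = i (act a V f))
    (he : ∀ V u, (∀ k, constantCoeff (V k) = 0) →
      e (skoBracket (embSKO hβ' (0, V, 0)) u) = b * constantCoeff (vdiv V) * e u)
    (hne : ∃ f, e (σ (i f)) ≠ 0) : ∃ k : ℕ, (k : ℂ) + (2 * a - conj (b * 2)) = 0 := by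
  obtain ⟨s, hs, hbracket⟩ := hσ.exists_vecField_equiv hβ hβ'
  refine SKO23.exists_natCast_add_weight_eq_zero hbracket
    (T := e.comp (σ.toLinearMap.comp i)) (fun h => ?_) fun V f hV => ?_
  · obtain ⟨f, hf⟩ := hne
    exact hf (LinearMap.congr_fun h f)
  · calc e (σ (i (act a V f)))
        = e (skoBracket (embSKO hβ' (0, s V, 0)) (σ (i f))) := by rw [← hi, hσ.map_bracket, hs]
      _ = b * constantCoeff (vdiv (s V)) * e (σ (i f)) := he _ _ hV

theorem IsGradedConj.exists_natCast_add_posWeight_eq_zero (hσ : IsGradedConj β σ) (hβ : β ≠ 1)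
    (hβ' : β ≠ -1) : ∃ k : ℕ, (k : ℂ) + (2 * posWeight β - conj (negWeight β * 2)) = 0 := by
  refine hσ.exists_natCast_add_weight_eq_zero hβ hβ'
    (embSKO hβ' ∘ₗ LinearMap.inr ℂ A (VecField × A) ∘ₗ LinearMap.inr ℂ VecField A)
    (valueAt β ∅) (fun V f => ?_) (fun V u hV => ?_) ?_
  · refine (skoBracket_ofVec_embSKO hβ' V _).trans (congrArg (embSKO hβ') ?_)
    simp [act_zero_right, vbracket_zero_right]
  · obtain ⟨p, rfl⟩ := embSKO_surjective hβ hβ' u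
    rw [skoBracket_ofVec_embSKO, valueAt_empty_embSKO, valueAt_empty_embSKO,
      constantCoeff_act hV]
  · obtain ⟨⟨f, V, h⟩, ⟨hf, hV, -⟩, hp⟩ := hσ.exists_map_embSKO_eq hβ hβ' (j := 1)
      (q := (1, 0, 0)) (by simp [coordGrade])
    obtain rfl : f = 0 := hf (by decide)
    obtain rfl : V = 0 := hV (by decide)
    refine ⟨h, ?_⟩
    have hval := congrArg (valueAt β ∅) hp
    rw [valueAt_empty_embSKO, map_one] at hval
    exact hval.trans_ne one_ne_zero

theorem IsGradedConj.exists_natCast_add_negWeight_eq_zero (hσ : IsGradedConj β σ) (hβ₀ : β ≠ 0)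
    (hβ : β ≠ 1) (hβ' : β ≠ -1) :
    ∃ k : ℕ, (k : ℂ) + (2 * negWeight β - conj (posWeight β * 2)) = 0 := by
  refine hσ.exists_natCast_add_weight_eq_zero hβ hβ'
    (embSKO hβ' ∘ₗ LinearMap.inl ℂ A (VecField × A)) (valueAt β {0, 1})
    (fun V f => ?_) (fun V u hV => ?_) ?_
  · refine (skoBracket_ofVec_embSKO hβ' V _).trans (congrArg (embSKO hβ') ?_)
    simp [act_zero_right, vbracket_zero_right]
  · obtain ⟨p, rfl⟩ := embSKO_surjective hβ hβ' u
    rw [skoBracket_ofVec_embSKO, valueAt_zero_one_embSKO, valueAt_zero_one_embSKO,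
      constantCoeff_act hV]
    ring
  · obtain ⟨⟨f, V, h⟩, ⟨-, hV, hh⟩, hp⟩ := hσ.exists_map_embSKO_eq hβ hβ' (j := -1)
      (q := (0, 0, 1)) (by simp [coordGrade])
    obtain rfl : V = 0 := hV (by decide)
    obtain rfl : h = 0 := hh (by decide)
    refine ⟨f, ?_⟩
    have hval := congrArg (valueAt β {0, 1}) hp
    rw [valueAt_zero_one_embSKO, map_one, mul_one] at hval
    exact hval.trans_ne (neg_ne_zero.mpr (mul_ne_zero two_ne_zero hβ₀))

theorem norm_eq_one_of_isGradedConj (hβ : β ≠ 1) (hβ' : β ≠ -1) (hσ : IsGradedConj β σ) :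
    ‖β‖ = 1 := by
  obtain ⟨k, hk⟩ := hσ.exists_natCast_add_posWeight_eq_zero hβ hβ'
  obtain rfl | hβ₀ := eq_or_ne β 0
  · simp only [posWeight, negWeight, neg_zero, zero_mul, mul_zero, zero_add, inv_one, zero_sub,
      map_mul, map_neg, map_one, map_ofNat] at hk
    have hk' : ((k + 1 : ℕ) : ℂ) + 1 = 0 := by
      push_cast
      linear_combination hk
    exact absurd hk' (Nat.cast_add_one_ne_zero _)
  obtain ⟨l, hl⟩ := hσ.exists_natCast_add_negWeight_eq_zero hβ₀ hβ hβ'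
  have hl' := congrArg conj hl
  simp only [map_mul, map_add, map_sub, map_natCast, map_ofNat, map_zero, Complex.conj_conj]
    at hk hl'
  have hkl : ((k + l : ℕ) : ℂ) = 0 := by
    push_cast
    linear_combination hk + hl'
  have hk₀ : (k : ℂ) = 0 :=
    Nat.cast_eq_zero.mpr (Nat.eq_zero_of_add_eq_zero_right (Nat.cast_eq_zero.mp hkl))
  refine (conj_negWeight_eq_posWeight_iff hβ').mp ?_
  linear_combination (hk₀ - hk) / 2

end Necessity

end SKO23

end

theorem lemma3p10 (β : ℂ) (hβ : β ≠ 1) (hβ' : β ≠ -1) :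
    ((∃ σ : SKO23.SKO β ≃ₛₗ[starRingEnd ℂ] SKO23.SKO β, SKO23.IsGradedConj β σ) ↔ ‖β‖ = 1) ∧
    (‖β‖ = 1 → ∀ c : ℂ, c ^ 2 = (starRingEnd ℂ) β →
      ∃! σ : SKO23.SKO β ≃ₛₗ[starRingEnd ℂ] SKO23.SKO β,
        SKO23.IsGradedConj β σ ∧
        (∀ X : Fin 2 → SKO23.A, ∃ u : SKO23.SKO β, (u : SKO23.Superfn) = SKO23.ofVec β X ∧
          (σ u : SKO23.Superfn) = SKO23.ofVec β (fun i => SKO23.conjA (X i))) ∧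
        (∀ f : SKO23.A, ∃ u : SKO23.SKO β, (u : SKO23.Superfn) = SKO23.ofNeg f ∧
          (σ u : SKO23.Superfn) = c • SKO23.ofPos β (SKO23.conjA f)) ∧
        (∀ f : SKO23.A, ∃ u : SKO23.SKO β, (u : SKO23.Superfn) = c • SKO23.ofPos β f ∧
          (σ u : SKO23.Superfn) = -SKO23.ofNeg (SKO23.conjA f))) := by
  refine ⟨⟨fun ⟨σ, hσ⟩ => SKO23.norm_eq_one_of_isGradedConj hβ hβ' hσ, fun hn => ?_⟩,
    fun hn c hc => SKO23.existsUnique_isGradedConj hβ hβ' hn hc⟩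
  obtain ⟨c, hc⟩ := IsAlgClosed.exists_pow_nat_eq ((starRingEnd ℂ) β) (n := 2) two_pos
  obtain ⟨σ, hσ, -⟩ := (SKO23.existsUnique_isGradedConj hβ hβ' hn hc).exists
  exact ⟨σ, hσ⟩
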